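/- Let $\mathbb{K}\in\{\mathbb{R},\mathbb{C}\}$, $n\in\mathbb{N}_0$ and $a<b$. Consider a hyperbolic boundary control system $(n,P_1,P_0,\mathcal{H},\widetilde W_B,\widetilde W_C)$ on $[a,b]$, $$\partial_t x=P_1\,\partial_\xi(\mathcal{H}x)+P_0\,\mathcal{H}x,\qquad u=\widetilde W_B\begin{bmatrix}(\mathcal{H}x)(b)\\(\mathcal{H}x)(a)\end{bmatrix},\qquad y=\widetilde W_C\begin{bmatrix}(\mathcal{H}x)(b)\\(\mathcal{H}x)(a)\end{bmatrix},$$ such that 1. $P_1\in\mathbb{K}^{n\times n}$ is invertible and self-adjoint; 2. $P_0\in L^\infty([a,b],\mathbb{K}^{n\times n})$; 3. $\mathcal{H}\in L^\infty([a,b],\mathbb{K}^{n\times n})$, $\mathcal{H}(\xi)$ is self-adjoint for a.e. $\xi$, and there are $c,C>0$ with $cI_n\le\mathcal{H}(\xi)\le CI_n$ for a.e. $\xi\in[a,b]$; 4. $\widetilde W_B\in\mathbb{K}^{n\times 2n}$ and $\begin{bmatrix}\widetilde W_B\\ \widetilde W_C\end{bmatrix}\in\mathbb{K}^{2n\times 2n}$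 have full rank; 5. the operator $A=P_1\frac{\partial}{\partial\xi}\mathcal{H}+P_0\mathcal{H}$ with domain $$\mathrm{D}(A)=\left\{x_0\in L^2([a,b],\mathbb{K}^n)\;:\;\mathcal{H}x_0\in H^1([a,b],\mathbb{K}^n),\ \widetilde W_B\begin{bmatrix}(\mathcal{H}x_0)(b)\\(\mathcal{H}x_0)(a)\end{bmatrix}=0\right\}$$ is the infinitesimal generator of a $C_0$-semigroup on $L^2([a,b],\mathbb{K}^n)$. Assume moreover that there are $0\le m\le n$ and $S,\mathcal{H}^D\in C^1([a,b],\mathbb{K}^{n\times n})$, with $S$ pointwise invertible and $\mathcal{H}^D$ pointwise diagonal and positive definite, such that $P_1\mathcal{H}=S^{-1}P_1^D\mathcal{H}^DS$ a.e. on $[a,b]$, where $P_1^D=\begin{pmatrix}I_m&0\\0&-I_{n-m}\end{pmatrix}$. Under the state transformation $\widetilde x=Sx$ the system becomes the diagonalised system $(n,P_1^D,P_0^D,\mathcal{H}^D,\widetilde W_B^D,\widetilde W_C^D)$, where $P_0^D=S\left[(S^{-1})'+P_0P_1^{-1}S^{-1}\right]P_1^D$ and $$\widetilde W_\bullet^D=\widetilde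 W_\bullet\begin{bmatrix}P_1^{-1}S^{-1}(b)P_1^D&0\\0&P_1^{-1}S^{-1}(a)P_1^D\end{bmatrix},\qquad \bullet\in\{B,C\}.$$ Let $E_+^D$ and $E_-^D$ be the spans of the eigenvectors of $P_1^D$ to positive and to negative eigenvalues, respectively, $\iota_\pm$ the embedding of $E_\pm^D$ into $\mathbb{K}^n$, $P_\pm^D=\iota_\pm\iota_\pm^*$ the orthogonal projection onto $E^D_\pm$, and $Q_\pm^D=\iota_\pm\left(\iota_\pm^*(\pm P_1^D)\iota_\pm\right)^{1/2}\iota_\pm^*$ (so $P_+^D=Q_+^D=\begin{pmatrix}I_m&0\\0&0\end{pmatrix}$ and $P_-^D=Q_-^D=\begin{pmatrix}0&0\\0&I_{n-m}\end{pmatrix}$). Then the $n\times n$ matrix $\widetilde W_B^D\begin{bmatrix}P_+^D\\P_-^D\end{bmatrix}$ is invertible, and there exist matrices $K,M\in\mathbb{K}^{n\times n}$ with $K$ invertible such that $$\widetilde W_B^D=K\begin{pmatrix}Q_+^D-MQ_-^D&\;Q_-^D-MQ_+^D\end{pmatrix}.$$ -/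

import Mathlib

open Set Filter Topology MeasureTheory
open scoped ComplexOrder Matrix

noncomputable section

/-! ### Strongly continuous semigroups and their generators -/

/-- `T t`, `t ≥ 0`, is a `C₀`-semigroup of bounded operators on `X` (values at negative times are
irrelevant). Only the topology of `X` enters, so the notion is the same for equivalent norms. -/
structure IsC0Semigroup {𝕜 X : Type*} [RCLike 𝕜] [AddCommGroup X] [Module 𝕜 X]
    [TopologicalSpace X] (T : ℝ → X →L[𝕜] X) : Prop where
  map_zero : T 0 = ContinuousLinearMap.id 𝕜 X
  map_add : ∀ s t : ℝ, 0 ≤ s → 0 ≤ t → T (s + t) = (T s).comp (T t)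
  tendsto_zero : ∀ x : X, Tendsto (fun t => T t x) (𝓝[>] 0) (𝓝 x)

/-- An unbounded operator is given by its graph: `A x y` means `x ∈ D(A)` and `A x = y`.
It generates a `C₀`-semigroup if, for some `C₀`-semigroup `T`, it is precisely the operator
`x ↦ lim_{t ↓ 0} (T t x - x) / t`, defined for those `x` for which the limit exists. -/
def GeneratesC0Semigroup (𝕜 : Type*) {X : Type*} [RCLike 𝕜] [AddCommGroup X] [Module 𝕜 X]
    [TopologicalSpace X] (A : X → X → Prop) : Prop :=
  ∃ T : ℝ → X →L[𝕜] X, IsC0Semigroup T ∧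
    ∀ x y : X, A x y ↔
      Tendsto (fun t : ℝ => ((t⁻¹ : ℝ) : 𝕜) • (T t x - x)) (𝓝[>] 0) (𝓝 y)

/-! ### Hyperbolic boundary control systems -/

/-- The data `(n, P₁, P₀, 𝓗, W_B, W_C)` of a linear hyperbolic boundary control system on `[a, b]`.
The columns of `W_B`, `W_C` are indexed by `Fin n ⊕ Fin n`: the left block acts on the value at
`b`, the right block on the value at `a`. -/
structure HBCS (𝕜 : Type*) (n : ℕ) where
  a : ℝ
  b : ℝ
  P₁ : Matrix (Fin n) (Fin n) 𝕜
  P₀ : ℝ → Matrix (Fin n) (Fin n) 𝕜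
  H : ℝ → Matrix (Fin n) (Fin n) 𝕜
  WB : Matrix (Fin n) (Fin n ⊕ Fin n) 𝕜
  WC : Matrix (Fin n) (Fin n ⊕ Fin n) 𝕜

/-- `v ∈ H¹([a, b], 𝕜ⁿ)` with (weak) derivative `w`: `w ∈ L²` and `v` is the (absolutely)
continuous primitive of `w`. -/
def HasH1Deriv {𝕜 : Type*} [RCLike 𝕜] {n : ℕ} (a b : ℝ) (v w : ℝ → Fin n → 𝕜) : Prop :=
  MemLp w 2 (volume.restrict (Icc a b)) ∧ ∀ ξ ∈ Icc a b, v ξ = v a + ∫ t in a..ξ, w t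

namespace HBCS

variable {𝕜 : Type*} [RCLike 𝕜] {n : ℕ}

/-- The state space `L²([a, b], 𝕜ⁿ)`. (The inner product weighted by a bounded, coercive `𝓗` gives
an equivalent norm, hence the same topology.) -/
abbrev StateSpace (sys : HBCS 𝕜 n) : Type _ :=
  Lp (EuclideanSpace 𝕜 (Fin n)) 2 (volume.restrict (Icc sys.a sys.b))

/-- The graph of `A = P₁ ∂_ξ 𝓗 + P₀ 𝓗` with domain
`{x ∈ X | 𝓗 x ∈ H¹, W_B [(𝓗 x)(b); (𝓗 x)(a)] = 0}`. Here `v` is the continuous representative of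
`𝓗 x` and `w` its derivative. -/
def operator (sys : HBCS 𝕜 n) (x y : sys.StateSpace) : Prop :=
  ∃ v w : ℝ → Fin n → 𝕜,
    HasH1Deriv sys.a sys.b v w ∧
    (∀ᵐ ξ ∂(volume.restrict (Icc sys.a sys.b)), v ξ = sys.H ξ *ᵥ (x ξ).ofLp) ∧
    sys.WB *ᵥ Sum.elim (v sys.b) (v sys.a) = 0 ∧
    (∀ᵐ ξ ∂(volume.restrict (Icc sys.a sys.b)),
      (y ξ).ofLp = sys.P₁ *ᵥ w ξ + sys.P₀ ξ *ᵥ v ξ)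

/-- The standing assumptions on a hyperbolic boundary control system. -/
structure StandingAssumption (sys : HBCS 𝕜 n) : Prop where
  a_lt_b : sys.a < sys.b
  P₁_isUnit : IsUnit sys.P₁
  P₁_isHermitian : sys.P₁.IsHermitian
  P₀_memLp : ∀ i j, MemLp (fun ξ => sys.P₀ ξ i j) ⊤ (volume.restrict (Icc sys.a sys.b))
  H_memLp : ∀ i j, MemLp (fun ξ => sys.H ξ i j) ⊤ (volume.restrict (Icc sys.a sys.b))
  H_isHermitian : ∀ᵐ ξ ∂(volume.restrict (Icc sys.a sys.b)), (sys.H ξ).IsHermitian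
  H_bounds : ∃ c C : ℝ, 0 < c ∧ 0 < C ∧ ∀ᵐ ξ ∂(volume.restrict (Icc sys.a sys.b)),
    (sys.H ξ - (c : 𝕜) • (1 : Matrix (Fin n) (Fin n) 𝕜)).PosSemidef ∧
    ((C : 𝕜) • (1 : Matrix (Fin n) (Fin n) 𝕜) - sys.H ξ).PosSemidef
  WB_rank : sys.WB.rank = n
  WBC_rank : (Matrix.fromRows sys.WB sys.WC).rank = 2 * n
  generates : GeneratesC0Semigroup 𝕜 sys.operator

end HBCS

/-! ### Spectral splitting of a Hermitian matrix -/

section Splitting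

variable {𝕜 : Type*} [RCLike 𝕜] {n : ℕ}

/-- `E₊`: the span of the eigenvectors of `P` to positive eigenvalues. -/
def posSpace (P : Matrix (Fin n) (Fin n) 𝕜) : Submodule 𝕜 (EuclideanSpace 𝕜 (Fin n)) :=
  Submodule.span 𝕜 {v | ∃ r : ℝ, 0 < r ∧ Matrix.toEuclideanLin P v = (r : 𝕜) • v}

/-- `E₋`: the span of the eigenvectors of `P` to negative eigenvalues. -/
def negSpace (P : Matrix (Fin n) (Fin n) 𝕜) : Submodule 𝕜 (EuclideanSpace 𝕜 (Fin n)) :=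
  Submodule.span 𝕜 {v | ∃ r : ℝ, r < 0 ∧ Matrix.toEuclideanLin P v = (r : 𝕜) • v}

/-- The matrix of the orthogonal projection onto a subspace `E` of `𝕜ⁿ`. -/
def projMatrix (E : Submodule 𝕜 (EuclideanSpace 𝕜 (Fin n))) : Matrix (Fin n) (Fin n) 𝕜 :=
  (Matrix.toEuclideanCLM (n := Fin n) (𝕜 := 𝕜)).symm E.starProjection

/-- `P₊ = ι₊ ι₊*`. -/
def projPos (P : Matrix (Fin n) (Fin n) 𝕜) : Matrix (Fin n) (Fin n) 𝕜 := projMatrix (posSpace P)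

/-- `P₋ = ι₋ ι₋*`. -/
def projNeg (P : Matrix (Fin n) (Fin n) 𝕜) : Matrix (Fin n) (Fin n) 𝕜 := projMatrix (negSpace P)

/-- `Q₊ = ι₊ (ι₊* P ι₊)^{1/2} ι₊*`, i.e. the square root of the positive semidefinite matrix
`P₊ P P₊ = ι₊ (ι₊* P ι₊) ι₊*`, which acts as `ι₊* P ι₊` on `E₊` and vanishes on its complement. -/
def rootPos (P : Matrix (Fin n) (Fin n) 𝕜) : Matrix (Fin n) (Fin n) 𝕜 :=
  cfc Real.sqrt (projPos P * P * projPos P)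

/-- `Q₋ = ι₋ (ι₋* (-P) ι₋)^{1/2} ι₋*`, i.e. the square root of `P₋ (-P) P₋`. -/
def rootNeg (P : Matrix (Fin n) (Fin n) 𝕜) : Matrix (Fin n) (Fin n) 𝕜 :=
  cfc Real.sqrt (projNeg P * (-P) * projNeg P)

end Splitting

/-! ### Diagonalisation -/

/-- `P₁ᴰ = diag(1, …, 1, -1, …, -1)` with `m` entries `1`. -/
def signMatrix (𝕜 : Type*) [RCLike 𝕜] (n m : ℕ) : Matrix (Fin n) (Fin n) 𝕜 :=
  Matrix.diagonal fun i => if (i : ℕ) < m then 1 else -1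

namespace HBCS

variable {𝕜 : Type*} [RCLike 𝕜] {n : ℕ}

/-- The `C¹`-diagonalisation assumption: `S, 𝓗ᴰ ∈ C¹([a, b], 𝕜ⁿˣⁿ)`, `S` pointwise invertible,
`𝓗ᴰ` diagonal and positive, and `P₁ 𝓗 = S⁻¹ P₁ᴰ 𝓗ᴰ S` (almost everywhere, as `𝓗 ∈ L^∞`). -/
structure IsC1Diagonalisation (sys : HBCS 𝕜 n) (m : ℕ) (S HD : ℝ → Matrix (Fin n) (Fin n) 𝕜) :
    Prop where
  m_le : m ≤ n
  S_contDiff : ∀ i j, ContDiffOn ℝ 1 (fun ξ => S ξ i j) (Icc sys.a sys.b)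
  HD_contDiff : ∀ i j, ContDiffOn ℝ 1 (fun ξ => HD ξ i j) (Icc sys.a sys.b)
  S_isUnit : ∀ ξ ∈ Icc sys.a sys.b, IsUnit (S ξ)
  HD_isDiag : ∀ ξ ∈ Icc sys.a sys.b, (HD ξ).IsDiag
  HD_posDef : ∀ ξ ∈ Icc sys.a sys.b, (HD ξ).PosDef
  diag_eq : ∀ᵐ ξ ∂(volume.restrict (Icc sys.a sys.b)),
    sys.P₁ * sys.H ξ = (S ξ)⁻¹ * signMatrix 𝕜 n m * HD ξ * S ξ

/-- The block matrix `diag(P₁⁻¹ S(b)⁻¹ P₁ᴰ, P₁⁻¹ S(a)⁻¹ P₁ᴰ)` transforming boundary values. -/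
def boundaryTransform (sys : HBCS 𝕜 n) (m : ℕ) (S : ℝ → Matrix (Fin n) (Fin n) 𝕜) :
    Matrix (Fin n ⊕ Fin n) (Fin n ⊕ Fin n) 𝕜 :=
  Matrix.fromBlocks (sys.P₁⁻¹ * (S sys.b)⁻¹ * signMatrix 𝕜 n m) 0
    0 (sys.P₁⁻¹ * (S sys.a)⁻¹ * signMatrix 𝕜 n m)

/-- The diagonalised system `(n, P₁ᴰ, P₀ᴰ, 𝓗ᴰ, W_Bᴰ, W_Cᴰ)`, obtained by the state transformation
`x ↦ S x`, where `P₀ᴰ = S ((S⁻¹)' + P₀ P₁⁻¹ S⁻¹) P₁ᴰ`. -/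
def diagonalise (sys : HBCS 𝕜 n) (m : ℕ) (S HD : ℝ → Matrix (Fin n) (Fin n) 𝕜) : HBCS 𝕜 n where
  a := sys.a
  b := sys.b
  P₁ := signMatrix 𝕜 n m
  P₀ := fun ξ => S ξ *
    (Matrix.of (fun i j => derivWithin (fun η => (S η)⁻¹ i j) (Icc sys.a sys.b) ξ)
      + sys.P₀ ξ * sys.P₁⁻¹ * (S ξ)⁻¹) * signMatrix 𝕜 n m
  H := HD
  WB := sys.WB * sys.boundaryTransform m S
  WC := sys.WC * sys.boundaryTransform m S

end HBCS

end

/-! Components with sign `+1` travel from `b` to `a`, the others from `a` to `b`, so `[P₊ᴰ; P₋ᴰ] k`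
is boundary data `k` at the incoming ends and zero at the outgoing ends. If the square matrix of the
theorem were singular, some `k ≠ 0` would give such data in the kernel of the boundary matrix, and
this is incompatible with generation.

Let `σᵢ ≥ 0` on `[a, b]` be the travel time from the incoming end and `wᵢ = kᵢ exp (-r σᵢ)`. In
diagonal coordinates `w` solves the principal part of `(r - A) x = 0` exactly. At the incoming ends
it equals `k`, at the outgoing ends it is `O(exp (-r c))` with `c` the least total travel time, so
the boundary condition fails only by `O(exp (-r c))` and an affine correction of that size repairs
it. The resulting `x ∈ D(A)` satisfies `‖(r - A) x‖ ≤ C ‖x‖ + C (r + 1) exp (-r c)`: derivatives of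
the coordinate change and `P₀` are of order zero.

A generator satisfies `r ‖x‖ ≤ C ‖(r - A) x‖` for large `r` (`GeneratesC0Semigroup.exists_norm_le`),
whence `‖x‖ = O(exp (-r c))`. But near the incoming end of a component with `kᵢ ≠ 0` the ansatz is
at least `|kᵢ| exp (-r c / 2)`, a contradiction as `r → ∞` (`false_of_resolvent_estimates`,
`HBCS.incoming_eq_zero`). Given invertibility, the factorization is block algebra
(`exists_factorization_of_isUnit`). -/

/-! ### Spectral projections of the sign matrix and the factorization -/

section SignMatrix

variable {𝕜 : Type*} [RCLike 𝕜] {n : ℕ}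

/-- The projection of `𝕜ⁿ` onto its first `m` coordinates. -/
def headProj (𝕜 : Type*) [RCLike 𝕜] (n m : ℕ) : Matrix (Fin n) (Fin n) 𝕜 :=
  Matrix.diagonal fun i => if (i : ℕ) < m then 1 else 0

/-- The projection of `𝕜ⁿ` onto its last `n - m` coordinates. -/
def tailProj (𝕜 : Type*) [RCLike 𝕜] (n m : ℕ) : Matrix (Fin n) (Fin n) 𝕜 :=
  Matrix.diagonal fun i => if (i : ℕ) < m then 0 else 1

/-- A symmetric projection whose range consists of generators of a span, all of which it fixes,
is the orthogonal projection onto that span. -/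
lemma projMatrix_span_eq (D : Matrix (Fin n) (Fin n) 𝕜) (hD : D.IsHermitian)
    (s : Set (EuclideanSpace 𝕜 (Fin n)))
    (h_mem : ∀ v, Matrix.toEuclideanLin D v ∈ s)
    (h_fix : ∀ w ∈ s, Matrix.toEuclideanLin D w = w) :
    projMatrix (Submodule.span 𝕜 s) = D := by
  rw [projMatrix, StarAlgEquiv.symm_apply_eq]
  ext1 v
  -- It remains that `v - D v` is orthogonal to the span: by symmetry `⟪D v, w⟫ = ⟪v, D w⟫`, and `D
  -- w = w` there.
  refine Submodule.eq_starProjection_of_mem_of_inner_eq_zero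
    (Submodule.subset_span (h_mem v)) fun w hw => ?_
  have hfix : Matrix.toEuclideanLin D w = w := by
    induction hw using Submodule.span_induction with
    | mem x hx => exact h_fix x hx
    | zero => simp
    | add x y _ _ hx hy => rw [map_add, hx, hy]
    | smul c x _ hx => rw [map_smul, hx]
  have hsymm := Matrix.isSymmetric_toEuclideanLin_iff.mpr hD v w
  rw [hfix] at hsymm
  rw [inner_sub_left, sub_eq_zero]
  exact hsymm.symm

/-- Where the diagonal entry is `-1`, an eigenvector to `r > 0` satisfies `(r + 1) wᵢ = 0`, so that
coordinate vanishes. -/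
lemma projPos_signMatrix (m : ℕ) : projPos (signMatrix 𝕜 n m) = headProj 𝕜 n m := by
  refine projMatrix_span_eq _ ?_ _ (fun v => ⟨1, one_pos, ?_⟩) ?_
  · refine Matrix.isHermitian_diagonal_of_self_adjoint _ (funext fun i => ?_)
    by_cases h : (i : ℕ) < m <;> simp [h]
  · ext i
    by_cases h : (i : ℕ) < m <;>
      simp [headProj, signMatrix, Matrix.mulVec_diagonal, h]
  · rintro w ⟨r, hr, hw⟩
    ext i
    by_cases h : (i : ℕ) < m
    · simp [headProj, Matrix.mulVec_diagonal, h]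
    · have hi : -w i = (r : 𝕜) * w i := by
        simpa [signMatrix, Matrix.mulVec_diagonal, h, RCLike.real_smul_eq_coe_mul] using congrArg (fun u => u i) hw
      have h0 : ((r + 1 : ℝ) : 𝕜) * w i = 0 := by
        push_cast
        linear_combination -hi
      rcases mul_eq_zero.mp h0 with h1 | h1
      · rw [RCLike.ofReal_eq_zero] at h1
        linarith
      · simp [headProj, Matrix.mulVec_diagonal, h, h1]

lemma projNeg_signMatrix (m : ℕ) : projNeg (signMatrix 𝕜 n m) = tailProj 𝕜 n m := by
  refine projMatrix_span_eq _ ?_ _ (fun v => ⟨-1, neg_one_lt_zero, ?_⟩) ?_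
  · refine Matrix.isHermitian_diagonal_of_self_adjoint _ (funext fun i => ?_)
    by_cases h : (i : ℕ) < m <;> simp [h]
  · ext i
    by_cases h : (i : ℕ) < m <;>
      simp [tailProj, signMatrix, Matrix.mulVec_diagonal, h]
  · rintro w ⟨r, hr, hw⟩
    ext i
    by_cases h : (i : ℕ) < m
    · have hi : w i = (r : 𝕜) * w i := by
        simpa [signMatrix, Matrix.mulVec_diagonal, h, RCLike.real_smul_eq_coe_mul] using congrArg (fun u => u i) hw
      have h0 : ((r - 1 : ℝ) : 𝕜) * w i = 0 := by
        push_cast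
        linear_combination -hi
      rcases mul_eq_zero.mp h0 with h1 | h1
      · rw [RCLike.ofReal_eq_zero] at h1
        linarith
      · simp [tailProj, Matrix.mulVec_diagonal, h, h1]
    · simp [tailProj, Matrix.mulVec_diagonal, h]

/-- The spectrum of an idempotent lies in `{0, 1}`, where the square root is the identity. -/
lemma cfc_sqrt_eq_self {D : Matrix (Fin n) (Fin n) 𝕜} (hD : D.IsHermitian)
    (hD2 : IsIdempotentElem D) : cfc Real.sqrt D = D := by
  have hsa : IsSelfAdjoint D := hD
  refine (cfc_congr (g := id) fun x hx => ?_).trans (cfc_id ℝ D)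
  rcases hD2.spectrum_subset ℝ hx with rfl | rfl <;> simp

lemma rootPos_signMatrix (m : ℕ) : rootPos (signMatrix 𝕜 n m) = headProj 𝕜 n m := by
  have h : headProj 𝕜 n m * signMatrix 𝕜 n m * headProj 𝕜 n m = headProj 𝕜 n m := by
    simp only [headProj, signMatrix, Matrix.diagonal_mul_diagonal]
    congr 1
    funext i
    by_cases h : (i : ℕ) < m <;> simp [h]
  rw [rootPos, projPos_signMatrix, h]
  refine cfc_sqrt_eq_self (Matrix.isHermitian_diagonal_of_self_adjoint _ (funext fun i => ?_)) ?_
  · by_cases h : (i : ℕ) < m <;> simp [h]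
  · simp [IsIdempotentElem, headProj]

lemma rootNeg_signMatrix (m : ℕ) : rootNeg (signMatrix 𝕜 n m) = tailProj 𝕜 n m := by
  have h : tailProj 𝕜 n m * -signMatrix 𝕜 n m * tailProj 𝕜 n m = tailProj 𝕜 n m := by
    simp only [tailProj, signMatrix, Matrix.diagonal_neg, Matrix.diagonal_mul_diagonal]
    congr 1
    funext i
    by_cases h : (i : ℕ) < m <;> simp [h]
  rw [rootNeg, projNeg_signMatrix, h]
  refine cfc_sqrt_eq_self (Matrix.isHermitian_diagonal_of_self_adjoint _ (funext fun i => ?_)) ?_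
  · by_cases h : (i : ℕ) < m <;> simp [h]
  · simp [IsIdempotentElem, tailProj]

/-- If `W [P; Q]` is invertible for complementary projections `P`, `Q`, then
`W = K [P - M Q, Q - M P]` with `K` invertible. -/
lemma exists_factorization_of_isUnit (W : Matrix (Fin n) (Fin n ⊕ Fin n) 𝕜)
    {P Q : Matrix (Fin n) (Fin n) 𝕜} (hPP : P * P = P) (hQQ : Q * Q = Q) (hPQ : P * Q = 0)
    (hQP : Q * P = 0) (hadd : P + Q = 1) (hK : IsUnit (W * Matrix.fromRows P Q)) :
    ∃ K M : Matrix (Fin n) (Fin n) 𝕜, IsUnit K ∧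
      W = K * Matrix.fromCols (P - M * Q) (Q - M * P) := by
  obtain ⟨A, B, rfl⟩ : ∃ A B, W = Matrix.fromCols A B :=
    ⟨_, _, (Matrix.fromCols_toCols W).symm⟩
  rw [Matrix.fromCols_mul_fromRows] at hK
  -- With `W = [A B]`, multiplying the desired identity by `P` and `Q` forces `K = A P + B Q` and `K
  -- M = -(A Q + B P)`.
  refine ⟨_, -((A * P + B * Q)⁻¹ * (A * Q + B * P)), hK, ?_⟩
  have hdet := (Matrix.isUnit_iff_isUnit_det _).mp hK
  have h1 : (A * P + B * Q) * P = A * P := by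
    rw [add_mul, Matrix.mul_assoc, Matrix.mul_assoc, hPP, hQP, mul_zero, add_zero]
  have h2 : (A * P + B * Q) * Q = B * Q := by
    rw [add_mul, Matrix.mul_assoc, Matrix.mul_assoc, hPQ, hQQ, mul_zero, zero_add]
  have h3 : (A * Q + B * P) * Q = A * Q := by
    rw [add_mul, Matrix.mul_assoc, Matrix.mul_assoc, hQQ, hPQ, mul_zero, add_zero]
  have h4 : (A * Q + B * P) * P = B * P := by
    rw [add_mul, Matrix.mul_assoc, Matrix.mul_assoc, hQP, hPP, mul_zero, zero_add]
  rw [Matrix.mul_fromCols, neg_mul, neg_mul, sub_neg_eq_add, sub_neg_eq_add,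
    mul_add (A * P + B * Q), mul_add (A * P + B * Q),
    h1, h2, Matrix.mul_assoc, Matrix.mul_assoc, Matrix.mul_nonsing_inv_cancel_left _ _ hdet,
    Matrix.mul_nonsing_inv_cancel_left _ _ hdet, h3, h4, ← mul_add, ← mul_add, hadd,
    add_comm Q P, hadd, mul_one, mul_one]

end SignMatrix

/-! ### Resolvent estimate for generators -/

section Semigroup

variable {𝕜 X : Type*} [RCLike 𝕜] [NormedAddCommGroup X] [NormedSpace 𝕜 X]

namespace IsC0Semigroup

variable {T : ℝ → X →L[𝕜] X}

lemma tendsto_nhdsGE (hT : IsC0Semigroup T) (x : X) :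
    Tendsto (fun t => T t x) (𝓝[≥] 0) (𝓝 x) := by
  rw [← Ioi_insert, nhdsWithin_insert, tendsto_sup]
  refine ⟨?_, hT.tendsto_zero x⟩
  rw [tendsto_pure_left]
  intro s hs
  rw [hT.map_zero]
  exact mem_of_mem_nhds hs

/-- Otherwise `‖T (t k)‖` is unbounded along some `t k → 0`, although every orbit `T (t k) x`
converges; this contradicts Banach–Steinhaus. -/
lemma exists_norm_le [CompleteSpace X] (hT : IsC0Semigroup T) :
    ∃ δ M : ℝ, 0 < δ ∧ 0 < M ∧ ∀ t ∈ Icc 0 δ, ‖T t‖ ≤ M := by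
  by_contra! H
  have h (k : ℕ) : ∃ t ∈ Icc (0 : ℝ) (1 / ((k : ℝ) + 1)), (k : ℝ) + 1 < ‖T t‖ :=
    H _ _ (by positivity) (by positivity)
  choose t ht htn using h
  have ht0 : Tendsto t atTop (𝓝[≥] 0) := tendsto_nhdsWithin_iff.mpr
    ⟨squeeze_zero (fun k => (ht k).1) (fun k => (ht k).2) tendsto_one_div_add_atTop_nhds_zero_nat,
      Eventually.of_forall fun k => (ht k).1⟩
  obtain ⟨C, hC⟩ := banach_steinhaus (g := fun k => T (t k)) fun x => by
    obtain ⟨C, hC⟩ := ((hT.tendsto_nhdsGE x).comp ht0).norm.bddAbove_range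
    exact ⟨C, fun k => hC ⟨k, rfl⟩⟩
  obtain ⟨k, hk⟩ := exists_nat_ge C
  linarith [hC k, htn k]

/-- For `s ≤ t`, factoring out `T s` reduces continuity from both sides to right continuity at `0`.
-/
lemma continuousOn_of_norm_le (hT : IsC0Semigroup T) {δ M : ℝ}
    (hM : ∀ t ∈ Icc 0 δ, ‖T t‖ ≤ M) (x : X) : ContinuousOn (fun t => T t x) (Icc 0 δ) := by
  have key : ∀ s t, 0 ≤ s → s ≤ t → t ≤ δ → ‖T s x - T t x‖ ≤ M * ‖T |s - t| x - x‖ := by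
    intro s t hs hst ht
    have h1 : T t x = T s (T |s - t| x) := by
      rw [abs_sub_comm, abs_of_nonneg (sub_nonneg.mpr hst), ← ContinuousLinearMap.comp_apply,
        ← hT.map_add _ _ hs (sub_nonneg.mpr hst), add_sub_cancel]
    rw [h1, ← map_sub, norm_sub_rev (T |s - t| x)]
    exact (T s).le_of_opNorm_le (hM s ⟨hs, hst.trans ht⟩) _
  intro t ht
  rw [ContinuousWithinAt, tendsto_iff_norm_sub_tendsto_zero]
  have habs : Tendsto (fun s => |s - t|) (𝓝[Icc 0 δ] t) (𝓝[≥] 0) := by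
    refine tendsto_nhdsWithin_iff.mpr ⟨?_, Eventually.of_forall fun s => abs_nonneg (s - t)⟩
    refine Tendsto.mono_left ?_ nhdsWithin_le_nhds
    have : Continuous fun s : ℝ => |s - t| := by fun_prop
    simpa using this.tendsto t
  have hlim : Tendsto (fun s => M * ‖T |s - t| x - x‖) (𝓝[Icc 0 δ] t) (𝓝 0) := by
    have := ((((hT.tendsto_nhdsGE x).comp habs).sub_const x).norm).const_mul M
    simpa using this
  refine squeeze_zero' (Eventually.of_forall fun s => norm_nonneg _) ?_ hlim
  filter_upwards [self_mem_nhdsWithin] with s hs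
  rcases le_total s t with h | h
  · exact key s t hs.1 h ht.2
  · rw [norm_sub_rev, abs_sub_comm]
    exact key t s ht.1 h hs.2

end IsC0Semigroup

/-- The resolvent estimate `r ‖x‖ ≤ C ‖(r - A) x‖` for the generator of a `C₀`-semigroup. -/
lemma GeneratesC0Semigroup.exists_norm_le [CompleteSpace X] {A : X → X → Prop}
    (hA : GeneratesC0Semigroup 𝕜 A) :
    ∃ C r₀ : ℝ, 0 < C ∧ ∀ r, r₀ ≤ r → ∀ x y, A x y → r * ‖x‖ ≤ C * ‖(r : 𝕜) • x - y‖ := by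
  obtain ⟨T, hT, hAT⟩ := hA
  obtain ⟨δ, M, hδ, hM0, hM⟩ := hT.exists_norm_le
  let _ : NormedSpace ℝ X := NormedSpace.restrictScalars ℝ 𝕜 X
  have hsm (c : ℝ) (x : X) : (c : 𝕜) • x = c • x := rfl
  -- For such `r` the endpoint term `exp (-r δ) T δ x` has norm at most `‖x‖ / 2` and can be
  -- absorbed.
  have hsmall : ∀ᶠ r : ℝ in atTop, M * Real.exp (-(r * δ)) ≤ 1 / 2 := by
    have h1 : Tendsto (fun r : ℝ => M * Real.exp (-(r * δ))) atTop (𝓝 (M * 0)) :=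
      (Real.tendsto_exp_neg_atTop_nhds_zero.comp
        (tendsto_id.atTop_mul_const hδ)).const_mul M
    rw [mul_zero] at h1
    exact h1.eventually_le_const (by norm_num)
  obtain ⟨r₀, hr₀⟩ := eventually_atTop.mp hsmall
  refine ⟨2 * M, max r₀ 1, by positivity, fun r hr x y hxy => ?_⟩
  have hr1 : 0 < r := lt_of_lt_of_le one_pos ((le_max_right _ _).trans hr)
  have hsm2 := hr₀ r ((le_max_left _ _).trans hr)
  set z := (r : 𝕜) • x - y with hz
  have hlim := (hAT x y).mp hxy
  -- The generator only provides right derivatives, which suffice for the mean value inequality used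
  -- below.
  have hder : ∀ t ∈ Ico 0 δ, HasDerivWithinAt (fun t => T t x) (T t y) (Ici t) t := by
    intro t ht
    rw [← hasDerivWithinAt_Ioi_iff_Ici, hasDerivWithinAt_iff_tendsto_slope' self_notMem_Ioi]
    have h1 : Tendsto (fun s => s - t) (𝓝[>] t) (𝓝[>] 0) := by
      refine tendsto_nhdsWithin_iff.mpr ⟨Tendsto.mono_left ?_ nhdsWithin_le_nhds, ?_⟩
      · have : Continuous fun s : ℝ => s - t := by fun_prop
        simpa using this.tendsto t
      · filter_upwards [self_mem_nhdsWithin] with s hs using sub_pos.mpr (mem_Ioi.mp hs)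
    refine (((T t).continuous.tendsto y).comp (hlim.comp h1)).congr' ?_
    filter_upwards [self_mem_nhdsWithin] with s hs
    have hs' : t < s := hs
    simp only [Function.comp_apply, slope_def_module, map_smul, map_sub]
    rw [← ContinuousLinearMap.comp_apply (T t), ← hT.map_add _ _ ht.1 (sub_pos.mpr hs').le,
      add_sub_cancel, hsm]
  have hexp (t : ℝ) : HasDerivAt (fun t => Real.exp (-(r * t))) (-r * Real.exp (-(r * t))) t := by
    have := (((hasDerivAt_id t).const_mul r).neg).exp
    simpa [mul_comm] using this
  have hec : ContinuousOn (fun t => Real.exp (-(r * t))) (Icc 0 δ) := by fun_prop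
  have hcont : ContinuousOn (fun t => Real.exp (-(r * t)) • T t x - x) (Icc 0 δ) :=
    (hec.smul (hT.continuousOn_of_norm_le hM x)).sub continuousOn_const
  -- The curve `exp (-r t) T t x` has derivative `-exp (-r t) T t z`, of norm at most `M ‖z‖ exp (-r
  -- t)`; the bound `B` is the integral of the latter.
  have hbound := image_norm_le_of_norm_deriv_right_le_deriv_boundary hcont
    (f' := fun t => -(Real.exp (-(r * t)) • T t z))
    (B := fun t => M * ‖z‖ / r * (1 - Real.exp (-(r * t))))
    (B' := fun t => M * ‖z‖ * Real.exp (-(r * t)))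
    (fun t ht => by
      refine (((hexp t).hasDerivWithinAt.smul (hder t ht)).sub_const x).congr_deriv ?_
      rw [hz, map_sub, map_smul, hsm, smul_sub, smul_smul]
      module)
    (by simp [hT.map_zero])
    (fun t => by
      refine (((hexp t).const_sub 1).const_mul (M * ‖z‖ / r)).congr_deriv ?_
      field_simp)
    (fun t ht => by
      rw [norm_neg, norm_smul, Real.norm_of_nonneg (Real.exp_pos _).le, mul_comm]
      exact mul_le_mul_of_nonneg_right ((T t).le_of_opNorm_le (hM t (Ico_subset_Icc_self ht)) z)
        (Real.exp_pos _).le)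
    (right_mem_Icc.mpr hδ.le)
  have h2 : ‖Real.exp (-(r * δ)) • T δ x‖ ≤ 1 / 2 * ‖x‖ := by
    rw [norm_smul, Real.norm_of_nonneg (Real.exp_pos _).le]
    calc _ ≤ Real.exp (-(r * δ)) * (M * ‖x‖) :=
          mul_le_mul_of_nonneg_left ((T δ).le_of_opNorm_le (hM δ (right_mem_Icc.mpr hδ.le)) x)
            (Real.exp_pos _).le
      _ = (M * Real.exp (-(r * δ))) * ‖x‖ := by ring
      _ ≤ _ := mul_le_mul_of_nonneg_right hsm2 (norm_nonneg _)
  have h3 : ‖x‖ ≤ ‖Real.exp (-(r * δ)) • T δ x‖ + ‖Real.exp (-(r * δ)) • T δ x - x‖ := by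
    rw [norm_sub_rev]
    exact norm_le_insert' _ _
  have h4 : M * ‖z‖ / r * (1 - Real.exp (-(r * δ))) ≤ M * ‖z‖ / r :=
    mul_le_of_le_one_right (by positivity) (by linarith [Real.exp_pos (-(r * δ))])
  have h5 : ‖x‖ ≤ 2 * (M * ‖z‖ / r) := by linarith
  calc r * ‖x‖ ≤ r * (2 * (M * ‖z‖ / r)) := mul_le_mul_of_nonneg_left h5 hr1.le
    _ = 2 * M * ‖z‖ := by field_simp

end Semigroup

/-! ### Uniform matrix bounds and an `L²` comparison -/

section Bounds

variable {𝕜 : Type*} [RCLike 𝕜] {n : ℕ}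

lemma norm_mulVec_le_of_norm_apply_le {A : Matrix (Fin n) (Fin n) 𝕜} {c : ℝ} (hc : 0 ≤ c)
    (hA : ∀ i j, ‖A i j‖ ≤ c) (v : Fin n → 𝕜) : ‖A *ᵥ v‖ ≤ n * c * ‖v‖ := by
  refine (pi_norm_le_iff_of_nonneg (by positivity)).mpr fun i => ?_
  calc ‖(A *ᵥ v) i‖ ≤ ∑ j, ‖A i j * v j‖ := norm_sum_le Finset.univ fun j => A i j * v j
    _ ≤ ∑ _j : Fin n, c * ‖v‖ := Finset.sum_le_sum fun j _ => by
        rw [norm_mul]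
        exact mul_le_mul (hA i j) (norm_le_pi_norm v j) (norm_nonneg _) hc
    _ = n * c * ‖v‖ := by simp [mul_assoc]

lemma exists_norm_mulVec_le_of_continuousOn {A : ℝ → Matrix (Fin n) (Fin n) 𝕜} {s : Set ℝ}
    (hs : IsCompact s) (hA : ContinuousOn A s) :
    ∃ C, 0 ≤ C ∧ ∀ ξ ∈ s, ∀ v, ‖A ξ *ᵥ v‖ ≤ C * ‖v‖ := by
  let _ : NormedAddCommGroup (Matrix (Fin n) (Fin n) 𝕜) := Matrix.normedAddCommGroup
  obtain ⟨c, hc⟩ := hs.exists_bound_of_continuousOn hA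
  refine ⟨n * max c 0, by positivity, fun ξ hξ v =>
    norm_mulVec_le_of_norm_apply_le (le_max_right _ _) (fun i j => ?_) v⟩
  exact (Matrix.norm_entry_le_entrywise_sup_norm _).trans ((hc ξ hξ).trans (le_max_left _ _))

lemma exists_norm_mulVec_le_of_memLp_top {α : Type*} {mα : MeasurableSpace α} {μ : Measure α}
    {A : α → Matrix (Fin n) (Fin n) 𝕜} (hA : ∀ i j, MemLp (fun ξ => A ξ i j) ⊤ μ) :
    ∃ C, 0 ≤ C ∧ ∀ᵐ ξ ∂μ, ∀ v, ‖A ξ *ᵥ v‖ ≤ C * ‖v‖ := by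
  set c : Fin n → Fin n → ℝ := fun i j => (eLpNorm (fun ξ => A ξ i j) ⊤ μ).toReal with hc
  have hc0 : ∀ i j, 0 ≤ c i j := fun i j => ENNReal.toReal_nonneg
  have hle : ∀ᵐ ξ ∂μ, ∀ i j, ‖A ξ i j‖ ≤ c i j := by
    refine ae_all_iff.mpr fun i => ae_all_iff.mpr fun j => ?_
    filter_upwards [ae_le_eLpNormEssSup (f := fun ξ => A ξ i j) (μ := μ)] with ξ hξ
    rw [← eLpNorm_exponent_top] at hξ
    simpa [hc] using ENNReal.toReal_mono (hA i j).2.ne hξ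
  have hsum : 0 ≤ ∑ i, ∑ j, c i j := Finset.sum_nonneg fun i _ => Finset.sum_nonneg fun j _ => hc0 i j
  refine ⟨n * ∑ i, ∑ j, c i j, by positivity, ?_⟩
  filter_upwards [hle] with ξ hξ v
  refine norm_mulVec_le_of_norm_apply_le hsum (fun i j => (hξ i j).trans ?_) v
  calc c i j ≤ ∑ j, c i j := Finset.single_le_sum (fun j _ => hc0 i j) (Finset.mem_univ j)
    _ ≤ _ := Finset.single_le_sum (f := fun i => ∑ j, c i j)
      (fun i _ => Finset.sum_nonneg fun j _ => hc0 i j) (Finset.mem_univ i)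

/-- Triangle inequality for the scalar majorant `C ‖f‖ + δ`; the power of the total mass is the `L²`
norm of `1`. -/
lemma MeasureTheory.Lp.norm_le_mul_norm_add_of_ae_le {α E F : Type*} {mα : MeasurableSpace α}
    {μ : Measure α} [IsFiniteMeasure μ] [NormedAddCommGroup E] [NormedAddCommGroup F]
    (f : Lp E 2 μ) (g : Lp F 2 μ) {C δ : ℝ} (hC : 0 ≤ C) (hδ : 0 ≤ δ)
    (h : ∀ᵐ ξ ∂μ, ‖g ξ‖ ≤ C * ‖f ξ‖ + δ) :
    ‖g‖ ≤ C * ‖f‖ + δ * μ.real univ ^ (1 / 2 : ℝ) := by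
  set f' : Lp ℝ 2 μ := (Lp.memLp f).norm.toLp with hf'
  set d : Lp ℝ 2 μ := indicatorConstLp 2 MeasurableSet.univ (measure_ne_top μ univ) δ with hd
  have hfn : ‖f'‖ = ‖f‖ := by
    rw [hf', Lp.norm_toLp, eLpNorm_norm, Lp.norm_def]
  have hdn : ‖d‖ = δ * μ.real univ ^ (1 / 2 : ℝ) := by
    rw [hd, norm_indicatorConstLp (by norm_num) (by norm_num), Real.norm_of_nonneg hδ]
    norm_num
  have hle : ‖g‖ ≤ ‖C • f' + d‖ := by
    refine Lp.norm_le_norm_of_ae_le ?_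
    filter_upwards [h, Lp.coeFn_add (C • f') d, Lp.coeFn_smul C f',
      (Lp.memLp f).norm.coeFn_toLp,
      indicatorConstLp_coeFn (p := 2) (hs := MeasurableSet.univ) (hμs := measure_ne_top μ univ)
        (c := δ)] with ξ h1 h2 h3 h4 h5
    rw [h2, Pi.add_apply, h3, Pi.smul_apply, hf', h4, hd, h5, indicator_univ, smul_eq_mul]
    exact h1.trans (le_abs_self _)
  calc ‖g‖ ≤ ‖C • f'‖ + ‖d‖ := hle.trans (norm_add_le _ _)
    _ = _ := by rw [norm_smul, Real.norm_of_nonneg hC, hfn, hdn]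

end Bounds

/-! ### Elements of the operator domain and lifting of boundary data -/

section Domain

variable {𝕜 : Type*} [RCLike 𝕜] {n : ℕ}

lemma ContinuousOn.memLp_Icc {E : Type*} [NormedAddCommGroup E] {a b : ℝ} {f : ℝ → E}
    (hf : ContinuousOn f (Icc a b)) (p : ENNReal) : MemLp f p (volume.restrict (Icc a b)) := by
  obtain ⟨C, hC⟩ := isCompact_Icc.exists_bound_of_continuousOn hf
  refine MemLp.of_bound (hf.aestronglyMeasurable_of_isCompact isCompact_Icc measurableSet_Icc) C ?_
  exact (ae_restrict_iff' measurableSet_Icc).mpr (Eventually.of_forall hC)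

lemma HasH1Deriv.of_hasDerivWithinAt {a b : ℝ} {v w : ℝ → Fin n → 𝕜}
    (hv : ∀ ξ ∈ Icc a b, HasDerivWithinAt v (w ξ) (Icc a b) ξ) (hw : ContinuousOn w (Icc a b)) :
    HasH1Deriv a b v w := by
  refine ⟨hw.memLp_Icc 2, fun ξ hξ => ?_⟩
  have hsub : Icc a ξ ⊆ Icc a b := Icc_subset_Icc_right hξ.2
  rw [intervalIntegral.integral_eq_sub_of_hasDerivAt_of_le hξ.1
    (fun t ht => ((hv t (hsub ht)).mono hsub).continuousWithinAt)
    (fun t ht => (hv t (hsub (Ioo_subset_Icc_self ht))).hasDerivAt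
      (Icc_mem_nhds ht.1 (ht.2.trans_le hξ.2)))
    ((hw.mono hsub).intervalIntegrable_of_Icc hξ.1), add_sub_cancel]

lemma ContinuousOn.mulVec_fun {s : Set ℝ} {A : ℝ → Matrix (Fin n) (Fin n) 𝕜} {v : ℝ → Fin n → 𝕜}
    (hA : ContinuousOn A s) (hv : ContinuousOn v s) : ContinuousOn (fun ξ => A ξ *ᵥ v ξ) s :=
  (continuous_fst.matrix_mulVec continuous_snd).comp_continuousOn (hA.prodMk hv)

/-- `C¹` functions satisfying the boundary condition give elements of the graph of `A`. -/
lemma HBCS.exists_operator (sys : HBCS 𝕜 n)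
    (hP₀ : ∀ i j, MemLp (fun ξ => sys.P₀ ξ i j) ⊤ (volume.restrict (Icc sys.a sys.b)))
    {N : ℝ → Matrix (Fin n) (Fin n) 𝕜} (hN : ContinuousOn N (Icc sys.a sys.b))
    (hHN : ∀ᵐ ξ ∂(volume.restrict (Icc sys.a sys.b)), sys.H ξ * N ξ = 1)
    {v w : ℝ → Fin n → 𝕜}
    (hv : ∀ ξ ∈ Icc sys.a sys.b, HasDerivWithinAt v (w ξ) (Icc sys.a sys.b) ξ)
    (hw : ContinuousOn w (Icc sys.a sys.b))
    (hbc : sys.WB *ᵥ Sum.elim (v sys.b) (v sys.a) = 0) :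
    ∃ x y : sys.StateSpace, sys.operator x y ∧
      (∀ᵐ ξ ∂(volume.restrict (Icc sys.a sys.b)), (x ξ).ofLp = N ξ *ᵥ v ξ) ∧
      (∀ᵐ ξ ∂(volume.restrict (Icc sys.a sys.b)),
        (y ξ).ofLp = sys.P₁ *ᵥ w ξ + sys.P₀ ξ *ᵥ v ξ) := by
  have hvc : ContinuousOn v (Icc sys.a sys.b) := fun ξ hξ => (hv ξ hξ).continuousWithinAt
  have hx : MemLp (fun ξ => WithLp.toLp 2 (N ξ *ᵥ v ξ) : ℝ → EuclideanSpace 𝕜 (Fin n)) 2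
      (volume.restrict (Icc sys.a sys.b)) :=
    MemLp.of_eval_piLp fun i =>
      ((continuous_apply i).comp_continuousOn (hN.mulVec_fun hvc)).memLp_Icc 2
  have hy : MemLp (fun ξ => WithLp.toLp 2 (sys.P₁ *ᵥ w ξ + sys.P₀ ξ *ᵥ v ξ) :
      ℝ → EuclideanSpace 𝕜 (Fin n)) 2 (volume.restrict (Icc sys.a sys.b)) := by
    refine MemLp.of_eval_piLp fun i => ?_
    refine MemLp.add (((continuous_apply i).comp_continuousOn
      ((continuousOn_const (c := sys.P₁)).mulVec_fun hw)).memLp_Icc 2) ?_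
    refine memLp_finsetSum Finset.univ (f := fun j ξ => sys.P₀ ξ i j * v ξ j) fun j _ => ?_
    exact MemLp.mul (p := ⊤) (q := 2) (((continuous_apply j).comp_continuousOn hvc).memLp_Icc 2)
      (hP₀ i j)
  refine ⟨hx.toLp, hy.toLp, ⟨v, w, .of_hasDerivWithinAt hv hw, ?_, hbc, ?_⟩, ?_, ?_⟩
  · filter_upwards [hx.coeFn_toLp, hHN] with ξ h1 h2
    rw [h1, Matrix.mulVec_mulVec, h2, Matrix.one_mulVec]
  · filter_upwards [hy.coeFn_toLp] with ξ h1
    rw [h1]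
  · filter_upwards [hx.coeFn_toLp] with ξ h1
    rw [h1]
  · filter_upwards [hy.coeFn_toLp] with ξ h1
    rw [h1]

/-- Boundary data can be lifted linearly and boundedly to affine functions. -/
lemma exists_affine_lift {a b : ℝ} (hab : a < b) (W : Matrix (Fin n) (Fin n ⊕ Fin n) 𝕜)
    (hW : W.rank = n) :
    ∃ C, 0 ≤ C ∧ ∀ e : Fin n → 𝕜, ∃ (g : ℝ → Fin n → 𝕜) (g' : Fin n → 𝕜),
      (∀ ξ, HasDerivAt g g' ξ) ∧ (∀ ξ ∈ Icc a b, ‖g ξ‖ ≤ C * ‖e‖) ∧ ‖g'‖ ≤ C * ‖e‖ ∧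
      W *ᵥ Sum.elim (g b) (g a) = e := by
  have hsurj : W.mulVecLin.range = ⊤ := by
    apply Submodule.eq_top_of_finrank_eq
    rw [Module.finrank_fin_fun]
    exact hW
  obtain ⟨R, hR⟩ := W.mulVecLin.exists_rightInverse_of_surjective hsurj
  have hRe (e : Fin n → 𝕜) : W *ᵥ R e = e := LinearMap.congr_fun hR e
  set Rc := LinearMap.toContinuousLinearMap R
  have hba : 0 < b - a := sub_pos.mpr hab
  -- The affine interpolant is bounded by `‖ga‖ + ‖gb - ga‖`, hence the `3`; its slope gives `2 / (b
  -- - a)`.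
  refine ⟨max 3 (2 * (b - a)⁻¹) * ‖Rc‖, by positivity, fun e => ?_⟩
  set gb : Fin n → 𝕜 := fun i => R e (Sum.inl i) with hgb
  set ga : Fin n → 𝕜 := fun i => R e (Sum.inr i) with hga
  have hRn : ‖R e‖ ≤ ‖Rc‖ * ‖e‖ := Rc.le_opNorm e
  have hgbn : ‖gb‖ ≤ ‖Rc‖ * ‖e‖ := (pi_norm_le_iff_of_nonneg (by positivity)).mpr fun i =>
    (norm_le_pi_norm (R e) (Sum.inl i)).trans hRn
  have hgan : ‖ga‖ ≤ ‖Rc‖ * ‖e‖ := (pi_norm_le_iff_of_nonneg (by positivity)).mpr fun i =>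
    (norm_le_pi_norm (R e) (Sum.inr i)).trans hRn
  have hdn : ‖gb - ga‖ ≤ 2 * (‖Rc‖ * ‖e‖) := (norm_sub_le _ _).trans (by linarith)
  have h0 : 0 ≤ ‖Rc‖ * ‖e‖ := by positivity
  refine ⟨fun ξ => ga + ((ξ - a) * (b - a)⁻¹) • (gb - ga), (b - a)⁻¹ • (gb - ga), ?_, ?_, ?_, ?_⟩
  · intro ξ
    have h1 : HasDerivAt (fun ξ : ℝ => (ξ - a) * (b - a)⁻¹) (b - a)⁻¹ ξ := by
      simpa using ((hasDerivAt_id ξ).sub_const a).mul_const (b - a)⁻¹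
    exact (h1.smul_const (gb - ga)).const_add ga
  · intro ξ hξ
    have h1 : 0 ≤ (ξ - a) * (b - a)⁻¹ := mul_nonneg (sub_nonneg.mpr hξ.1) (inv_nonneg.mpr hba.le)
    have h2 : (ξ - a) * (b - a)⁻¹ ≤ 1 := by
      rw [← div_eq_mul_inv, div_le_one hba]
      linarith [hξ.2]
    calc _ ≤ ‖ga‖ + ‖((ξ - a) * (b - a)⁻¹) • (gb - ga)‖ := norm_add_le _ _
      _ ≤ ‖Rc‖ * ‖e‖ + 1 * (2 * (‖Rc‖ * ‖e‖)) := by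
        rw [norm_smul, Real.norm_of_nonneg h1]
        exact add_le_add hgan (mul_le_mul h2 hdn (norm_nonneg _) zero_le_one)
      _ = 3 * (‖Rc‖ * ‖e‖) := by ring
      _ ≤ _ := by
        rw [mul_assoc]
        exact mul_le_mul_of_nonneg_right (le_max_left _ _) h0
  · rw [norm_smul, Real.norm_of_nonneg (inv_nonneg.mpr hba.le)]
    calc _ ≤ (b - a)⁻¹ * (2 * (‖Rc‖ * ‖e‖)) :=
          mul_le_mul_of_nonneg_left hdn (inv_nonneg.mpr hba.le)
      _ = (2 * (b - a)⁻¹) * (‖Rc‖ * ‖e‖) := by ring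
      _ ≤ _ := by
        rw [mul_assoc (max _ _)]
        exact mul_le_mul_of_nonneg_right (le_max_right _ _) h0
  · have hsum : Sum.elim gb ga = R e := by
      ext (i | i) <;> rfl
    simp only [sub_self, zero_mul, zero_smul, add_zero, mul_inv_cancel₀ hba.ne', one_smul,
      add_sub_cancel]
    rw [hsum, hRe]

end Domain

/-! ### Exponential profiles and the contradiction for large `r` -/

section Wave

variable {𝕜 : Type*} [RCLike 𝕜] {n : ℕ}

/-- The exponential profile with components `k i * exp (-r σᵢ(ξ))`. -/
noncomputable def expProfile (k : Fin n → 𝕜) (σ : Fin n → ℝ → ℝ) (r ξ : ℝ) : Fin n → 𝕜 :=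
  fun i => k i * ((Real.exp (-(r * σ i ξ)) : ℝ) : 𝕜)

lemma norm_expProfile_apply (k : Fin n → 𝕜) (σ : Fin n → ℝ → ℝ) (r ξ : ℝ) (i : Fin n) :
    ‖expProfile k σ r ξ i‖ = ‖k i‖ * Real.exp (-(r * σ i ξ)) := by
  rw [expProfile, norm_mul, RCLike.norm_ofReal, abs_of_pos (Real.exp_pos _)]

lemma hasDerivAt_expProfile (k : Fin n → 𝕜) {σ d : Fin n → ℝ → ℝ} {ξ : ℝ}
    (hσ : ∀ i, HasDerivAt (σ i) (-d i ξ) ξ) (r : ℝ) :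
    HasDerivAt (expProfile k σ r)
      ((r : 𝕜) • (Matrix.diagonal (fun i => (d i ξ : 𝕜)) *ᵥ expProfile k σ r ξ)) ξ := by
  refine hasDerivAt_pi.mpr fun i => ?_
  have h := ((RCLike.ofRealCLM (K := 𝕜)).hasFDerivAt.comp_hasDerivAt ξ
    ((hσ i).const_mul r).neg.exp).const_mul (k i)
  refine h.congr_deriv ?_
  simp only [RCLike.ofRealCLM_apply, Pi.neg_apply, Pi.smul_apply, Matrix.mulVec_diagonal, expProfile, smul_eq_mul]
  push_cast
  ring

/-- Used at both ends, with `p` at `b` and its negation at `a`: incoming components are exact there,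
outgoing ones exponentially small. -/
lemma norm_expProfile_sub_le (k : Fin n → 𝕜) {σ : Fin n → ℝ → ℝ} {c r ξ : ℝ} (hr : 0 ≤ r)
    (p : Fin n → Prop) [DecidablePred p] (h0 : ∀ i, p i → σ i ξ = 0)
    (hc : ∀ i, ¬p i → c ≤ σ i ξ) :
    ‖expProfile k σ r ξ - fun i => if p i then k i else 0‖ ≤ ‖k‖ * Real.exp (-(r * c)) := by
  refine (pi_norm_le_iff_of_nonneg (by positivity)).mpr fun i => ?_
  by_cases hi : p i
  · simp only [Pi.sub_apply, expProfile, h0 i hi, hi]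
    simp only [mul_zero, neg_zero, Real.exp_zero, RCLike.ofReal_one, mul_one, if_true, sub_self,
      norm_zero]
    positivity
  · rw [Pi.sub_apply, if_neg hi, sub_zero, norm_expProfile_apply]
    refine mul_le_mul (norm_le_pi_norm k i) (Real.exp_le_exp.mpr ?_) (Real.exp_pos _).le
      (norm_nonneg _)
    exact neg_le_neg (mul_le_mul_of_nonneg_left (hc i hi) hr)

lemma hasDerivWithinAt_mulVec {G G' : ℝ → Matrix (Fin n) (Fin n) 𝕜} {w : ℝ → Fin n → 𝕜}
    {w' : Fin n → 𝕜} {s : Set ℝ} {ξ : ℝ}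
    (hG : ∀ i j, HasDerivWithinAt (fun η => G η i j) (G' ξ i j) s ξ)
    (hw : HasDerivWithinAt w w' s ξ) :
    HasDerivWithinAt (fun η => G η *ᵥ w η) (G' ξ *ᵥ w ξ + G ξ *ᵥ w') s ξ := by
  refine hasDerivWithinAt_pi.mpr fun i => ?_
  have h := HasDerivWithinAt.fun_sum (u := Finset.univ) fun j _ =>
    (hG i j).mul (hasDerivWithinAt_pi.mp hw j)
  refine h.congr_deriv ?_
  simp [Matrix.mulVec, dotProduct, Finset.sum_add_distrib]

lemma EuclideanSpace.exists_norm_le_mul_norm_ofLp (𝕜 : Type*) [RCLike 𝕜] (n : ℕ) :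
    ∃ C, 0 ≤ C ∧ ∀ v : EuclideanSpace 𝕜 (Fin n), ‖v‖ ≤ C * ‖v.ofLp‖ :=
  let e : (Fin n → 𝕜) →L[𝕜] EuclideanSpace 𝕜 (Fin n) := (EuclideanSpace.equiv (Fin n) 𝕜).symm
  ⟨‖e‖, norm_nonneg _, fun v => e.le_opNorm v.ofLp⟩

/-- A family of vectors satisfying a resolvent estimate with an exponentially small defect cannot
be of half that exponential order. -/
lemma false_of_resolvent_estimates {C₀ C₁ C₂ C₃ C₄ c r₀ : ℝ} (hC₀ : 0 ≤ C₀) (hC₂ : 0 ≤ C₂)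
    (hC₃ : 0 < C₃) (hc : 0 < c)
    (h : ∀ r, r₀ ≤ r → 1 ≤ r → ∃ s z : ℝ, 0 ≤ s ∧ r * s ≤ C₀ * z ∧
      z ≤ C₁ * s + C₂ * (r + 1) * Real.exp (-(r * c)) ∧
      C₃ * Real.exp (-(r * (c / 2))) ≤ C₄ * s + C₄ * Real.exp (-(r * c))) (hC₄ : 0 ≤ C₄) :
    False := by
  have hlim : Tendsto (fun r : ℝ => (C₄ * (4 * C₀ * C₂ + 1)) * Real.exp (-(r * (c / 2)))) atTop
      (𝓝 ((C₄ * (4 * C₀ * C₂ + 1)) * 0)) :=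
    (Real.tendsto_exp_neg_atTop_nhds_zero.comp
      (tendsto_id.atTop_mul_const (half_pos hc))).const_mul _
  rw [mul_zero] at hlim
  -- The threshold `2 C₀ C₁` lets half of `r s` absorb `C₀ C₁ s`; `r ≥ 1` gives `r + 1 ≤ 2 r`, so
  -- that `r` cancels in `f5`.
  obtain ⟨r, hr, h0, h1, h2⟩ := ((hlim.eventually_lt_const hC₃).and
    ((eventually_ge_atTop r₀).and ((eventually_ge_atTop 1).and
      (eventually_ge_atTop (2 * (C₀ * C₁)))))).exists
  obtain ⟨s, z, hs, e1, e2, e3⟩ := h r h0 h1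
  have hE : Real.exp (-(r * c)) = Real.exp (-(r * (c / 2))) * Real.exp (-(r * (c / 2))) := by
    rw [← Real.exp_add]
    ring_nf
  set E := Real.exp (-(r * (c / 2))) with hEdef
  have hEpos : 0 < E := Real.exp_pos _
  rw [hE] at e2 e3
  have f1 : r * s ≤ C₀ * (C₁ * s + C₂ * (r + 1) * (E * E)) :=
    e1.trans (mul_le_mul_of_nonneg_left e2 hC₀)
  have f2 : 2 * (C₀ * C₁) * s ≤ r * s := mul_le_mul_of_nonneg_right h2 hs
  have f3 : 0 ≤ C₀ * C₂ * (E * E) := by positivity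
  have f4 : C₀ * C₂ * (E * E) * (r + 1) ≤ C₀ * C₂ * (E * E) * (2 * r) :=
    mul_le_mul_of_nonneg_left (by linarith) f3
  have f5 : r * s ≤ r * (4 * C₀ * C₂ * (E * E)) := by nlinarith
  have f6 : s ≤ 4 * C₀ * C₂ * (E * E) := le_of_mul_le_mul_left f5 (by linarith)
  have f7 : C₃ * E ≤ (C₄ * (4 * C₀ * C₂ + 1) * E) * E := by
    have := mul_le_mul_of_nonneg_left f6 hC₄
    linarith
  exact absurd (le_of_mul_le_mul_right f7 hEpos) (not_le.mpr hr)

end Wave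

/-! ### The exponential ansatz in the domain of the operator -/

section Ansatz

variable {𝕜 : Type*} [RCLike 𝕜] {n : ℕ}

/-- Pointwise defect of the exponential ansatz `G w + g` in the resolvent equation. -/
lemma norm_resolvent_defect_le {P P₀ N L G G' D : Matrix (Fin n) (Fin n) 𝕜}
    {w g g' : Fin n → 𝕜} {r cP cP₀ cN cL cG cG' δ : ℝ} (hr : 0 ≤ r) (hcP : 0 ≤ cP)
    (hcP₀ : 0 ≤ cP₀) (hcN : 0 ≤ cN) (hcL : 0 ≤ cL) (hcG : 0 ≤ cG) (hcG' : 0 ≤ cG')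
    (hP : ∀ v, ‖P *ᵥ v‖ ≤ cP * ‖v‖) (hP₀ : ∀ v, ‖P₀ *ᵥ v‖ ≤ cP₀ * ‖v‖)
    (hN : ∀ v, ‖N *ᵥ v‖ ≤ cN * ‖v‖) (hL : ∀ v, ‖L *ᵥ v‖ ≤ cL * ‖v‖)
    (hG : ∀ v, ‖G *ᵥ v‖ ≤ cG * ‖v‖) (hG' : ∀ v, ‖G' *ᵥ v‖ ≤ cG' * ‖v‖)
    (hLNG : L * (N * G) = 1) (hPGD : P * G * D = N * G) (hg : ‖g‖ ≤ δ) (hg' : ‖g'‖ ≤ δ) :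
    ‖w‖ ≤ cL * ‖N *ᵥ (G *ᵥ w + g)‖ + cL * cN * δ ∧
    ‖(r : 𝕜) • (N *ᵥ (G *ᵥ w + g)) -
        (P *ᵥ (G' *ᵥ w + G *ᵥ ((r : 𝕜) • (D *ᵥ w)) + g') + P₀ *ᵥ (G *ᵥ w + g))‖ ≤
      (cP * cG' + cP₀ * cG) * cL * ‖N *ᵥ (G *ᵥ w + g)‖ +
        (cN + cP + cP₀ + (cP * cG' + cP₀ * cG) * cL * cN) * (r + 1) * δ := by
  have hδ : 0 ≤ δ := (norm_nonneg _).trans hg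
  have hNg : ‖N *ᵥ g‖ ≤ cN * δ := (hN g).trans (mul_le_mul_of_nonneg_left hg hcN)
  have hw : ‖w‖ ≤ cL * ‖N *ᵥ (G *ᵥ w + g)‖ + cL * cN * δ := by
    have h1 : w = L *ᵥ (N *ᵥ (G *ᵥ w + g) - N *ᵥ g) := by
      rw [Matrix.mulVec_add, add_sub_cancel_right, Matrix.mulVec_mulVec, Matrix.mulVec_mulVec,
        Matrix.mul_assoc, hLNG, Matrix.one_mulVec]
    calc ‖w‖ = ‖L *ᵥ (N *ᵥ (G *ᵥ w + g) - N *ᵥ g)‖ := by rw [← h1]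
      _ ≤ cL * (‖N *ᵥ (G *ᵥ w + g)‖ + cN * δ) :=
        (hL _).trans (mul_le_mul_of_nonneg_left ((norm_sub_le _ _).trans (by gcongr)) hcL)
      _ = _ := by ring
  refine ⟨hw, ?_⟩
  -- The terms of order `r` in `w` cancel by this identity.
  have hkey : P *ᵥ (G *ᵥ (D *ᵥ w)) = N *ᵥ (G *ᵥ w) := by
    simp only [Matrix.mulVec_mulVec, ← hPGD, Matrix.mul_assoc]
  have hid : (r : 𝕜) • (N *ᵥ (G *ᵥ w + g)) -
      (P *ᵥ (G' *ᵥ w + G *ᵥ ((r : 𝕜) • (D *ᵥ w)) + g') + P₀ *ᵥ (G *ᵥ w + g)) =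
      (r : 𝕜) • (N *ᵥ g) - P *ᵥ g' - P₀ *ᵥ g - (P *ᵥ (G' *ᵥ w) + P₀ *ᵥ (G *ᵥ w)) := by
    simp only [Matrix.mulVec_add, Matrix.mulVec_smul, hkey, smul_add]
    abel
  rw [hid]
  have e1 : ‖(r : 𝕜) • (N *ᵥ g)‖ ≤ r * (cN * δ) := by
    rw [norm_smul, RCLike.norm_ofReal, abs_of_nonneg hr]
    exact mul_le_mul_of_nonneg_left hNg hr
  have e2 : ‖P *ᵥ g'‖ ≤ cP * δ := (hP _).trans (by gcongr)
  have e3 : ‖P₀ *ᵥ g‖ ≤ cP₀ * δ := (hP₀ _).trans (by gcongr)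
  have e4 : ‖P *ᵥ (G' *ᵥ w)‖ ≤ cP * (cG' * ‖w‖) := (hP _).trans (by gcongr; exact hG' w)
  have e5 : ‖P₀ *ᵥ (G *ᵥ w)‖ ≤ cP₀ * (cG * ‖w‖) := (hP₀ _).trans (by gcongr; exact hG w)
  set X := ‖N *ᵥ (G *ᵥ w + g)‖ with hX
  have hc : 0 ≤ cP * cG' + cP₀ * cG := by positivity
  have e6 := mul_le_mul_of_nonneg_left hw hc
  have e7 : 0 ≤ cN * δ := by positivity
  have e8 : 0 ≤ (cP + cP₀ + (cP * cG' + cP₀ * cG) * cL * cN) * δ * r := by positivity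
  calc _ ≤ ‖(r : 𝕜) • (N *ᵥ g)‖ + ‖P *ᵥ g'‖ + ‖P₀ *ᵥ g‖ +
        (‖P *ᵥ (G' *ᵥ w)‖ + ‖P₀ *ᵥ (G *ᵥ w)‖) := by
        refine (norm_sub_le _ _).trans (add_le_add ?_ (norm_add_le _ _))
        refine (norm_sub_le _ _).trans (add_le_add ?_ le_rfl)
        exact norm_sub_le _ _
    _ ≤ r * (cN * δ) + cP * δ + cP₀ * δ + (cP * cG' + cP₀ * cG) * ‖w‖ := by linarith
    _ ≤ _ := by linarith

/-- The set near the boundary where a continuous nonnegative phase is small has positive measure. -/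
lemma measureReal_phase_pos {a b c : ℝ} (hab : a < b) {σ : ℝ → ℝ} (hσ : Continuous σ)
    (hc : 0 < c) (h0 : ∃ ξ ∈ Icc a b, σ ξ = 0) :
    0 < (volume.restrict (Icc a b)).real {ξ | σ ξ < c} := by
  obtain ⟨ξ, hξ, h0⟩ := h0
  have hopen : IsOpen {ξ | σ ξ < c} := isOpen_lt hσ continuous_const
  -- The zero of the phase may be an endpoint, so a nearby interior point is used.
  rw [← closure_Ioo hab.ne] at hξ
  obtain ⟨η, hη⟩ := mem_closure_iff.mp hξ _ hopen (by simpa [h0] using hc)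
  have hpos : 0 < volume ({ξ | σ ξ < c} ∩ Ioo a b) :=
    (hopen.inter isOpen_Ioo).measure_pos _ ⟨η, hη⟩
  refine ENNReal.toReal_pos (ne_of_gt ?_) (measure_ne_top _ _)
  rw [Measure.restrict_apply hopen.measurableSet]
  exact hpos.trans_le (measure_mono (inter_subset_inter_right _ Ioo_subset_Icc_self))

/-- If the operator of a boundary control system with coordinates `v = G w` in which the principal
part is diagonal generates a semigroup, then no nonzero incoming boundary data (with vanishing
outgoing data) satisfies the boundary condition. Here `σ i` is the travel time of the `i`-th
component from its incoming end, which is `b` if `p i`, and `a` otherwise. -/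
lemma HBCS.incoming_eq_zero (sys : HBCS 𝕜 n) (hab : sys.a < sys.b)
    (hP₀ : ∀ i j, MemLp (fun ξ => sys.P₀ ξ i j) ⊤ (volume.restrict (Icc sys.a sys.b)))
    (hWB : sys.WB.rank = n) (hgen : GeneratesC0Semigroup 𝕜 sys.operator)
    {N L G G' : ℝ → Matrix (Fin n) (Fin n) 𝕜} {σ d : Fin n → ℝ → ℝ}
    (hN : ContinuousOn N (Icc sys.a sys.b)) (hL : ContinuousOn L (Icc sys.a sys.b))
    (hG' : ContinuousOn G' (Icc sys.a sys.b))
    (hGG' : ∀ ξ ∈ Icc sys.a sys.b, ∀ i j,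
      HasDerivWithinAt (fun η => G η i j) (G' ξ i j) (Icc sys.a sys.b) ξ)
    (hHN : ∀ᵐ ξ ∂(volume.restrict (Icc sys.a sys.b)), sys.H ξ * N ξ = 1)
    (hLNG : ∀ ξ ∈ Icc sys.a sys.b, L ξ * (N ξ * G ξ) = 1)
    (hPGD : ∀ ξ ∈ Icc sys.a sys.b,
      sys.P₁ * G ξ * Matrix.diagonal (fun i => (d i ξ : 𝕜)) = N ξ * G ξ)
    (hσd : ∀ i ξ, HasDerivAt (σ i) (-d i ξ) ξ) (hd : ∀ i, Continuous (d i))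
    {c : ℝ} (hc : 0 < c) (p : Fin n → Prop) [DecidablePred p]
    (hpb : ∀ i, p i → σ i sys.b = 0) (hpa : ∀ i, p i → c ≤ σ i sys.a)
    (hna : ∀ i, ¬p i → σ i sys.a = 0) (hnb : ∀ i, ¬p i → c ≤ σ i sys.b)
    (k : Fin n → 𝕜)
    (hk : sys.WB *ᵥ Sum.elim (G sys.b *ᵥ fun i => if p i then k i else 0)
      (G sys.a *ᵥ fun i => if p i then 0 else k i) = 0) : k = 0 := by
  by_contra hk0
  obtain ⟨i₀, hi₀⟩ := Function.ne_iff.mp hk0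
  have haI : sys.a ∈ Icc sys.a sys.b := left_mem_Icc.mpr hab.le
  have hbI : sys.b ∈ Icc sys.a sys.b := right_mem_Icc.mpr hab.le
  have hG : ContinuousOn G (Icc sys.a sys.b) := continuousOn_pi.mpr fun i =>
    continuousOn_pi.mpr fun j ξ hξ => (hGG' ξ hξ i j).continuousWithinAt
  obtain ⟨cN, hcN, hNb⟩ := exists_norm_mulVec_le_of_continuousOn isCompact_Icc hN
  obtain ⟨cL, hcL, hLb⟩ := exists_norm_mulVec_le_of_continuousOn isCompact_Icc hL
  obtain ⟨cG, hcG, hGb⟩ := exists_norm_mulVec_le_of_continuousOn isCompact_Icc hG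
  obtain ⟨cG', hcG', hGb'⟩ := exists_norm_mulVec_le_of_continuousOn isCompact_Icc hG'
  obtain ⟨cP, hcP, hPb⟩ := exists_norm_mulVec_le_of_continuousOn isCompact_Icc
    (continuousOn_const (c := sys.P₁) (s := Icc sys.a sys.b))
  obtain ⟨cP₀, hcP₀, hP₀b⟩ := exists_norm_mulVec_le_of_memLp_top hP₀
  obtain ⟨cE, hcE, hEb⟩ := EuclideanSpace.exists_norm_le_mul_norm_ofLp 𝕜 n
  obtain ⟨cg, hcg, hlift⟩ := exists_affine_lift hab sys.WB hWB
  obtain ⟨C₀, r₀, hC₀, hres⟩ := hgen.exists_norm_le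
  set cW := ‖LinearMap.toContinuousLinearMap sys.WB.mulVecLin‖ with hcW
  have hWb (e : Fin n ⊕ Fin n → 𝕜) : ‖sys.WB *ᵥ e‖ ≤ cW * ‖e‖ :=
    (LinearMap.toContinuousLinearMap sys.WB.mulVecLin).le_opNorm e
  have hcW0 : 0 ≤ cW := norm_nonneg _
  set μ := volume.restrict (Icc sys.a sys.b) with hμ
  set V := μ.real univ ^ (1 / 2 : ℝ) with hV
  have hV0 : 0 ≤ V := by positivity
  have hσc (i : Fin n) : Continuous (σ i) :=
    continuous_iff_continuousAt.mpr fun ξ => (hσd i ξ).continuousAt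
  -- On `J` the component `i₀` of the profile has modulus at least `‖k i₀‖ exp (-r c / 2)`.
  set J := {ξ | σ i₀ ξ < c / 2} with hJ
  have hJm : MeasurableSet J := (isOpen_lt (hσc i₀) continuous_const).measurableSet
  have hJpos : 0 < μ.real J := measureReal_phase_pos hab (hσc i₀) (half_pos hc) <| by
    by_cases h : p i₀
    · exact ⟨_, hbI, hpb _ h⟩
    · exact ⟨_, haI, hna _ h⟩
  set U := μ.real J ^ (1 / 2 : ℝ) with hU
  have hU0 : 0 < U := Real.rpow_pos_of_pos hJpos _
  set B := cW * (cG * ‖k‖) with hB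
  have hB0 : 0 ≤ B := by positivity
  set A₁ := (cP * cG' + cP₀ * cG) * cL with hA₁
  set A₂ := cN + cP + cP₀ + (cP * cG' + cP₀ * cG) * cL * cN with hA₂
  have hA₁0 : 0 ≤ A₁ := by positivity
  have hA₂0 : 0 ≤ A₂ := by positivity
  refine false_of_resolvent_estimates (C₀ := C₀) (C₁ := cE * A₁) (C₂ := cE * A₂ * (cg * B) * V)
    (C₃ := ‖k i₀‖ * U) (C₄ := cL + cL * cN * (cg * B) * V) (c := c) (r₀ := r₀) hC₀.le
    (by positivity) (mul_pos (norm_pos_iff.mpr hi₀) hU0) hc (fun r hr₀ hr₁ => ?_) (by positivity)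
  have hr : 0 ≤ r := zero_le_one.trans hr₁
  set w := expProfile k σ r with hw
  have hwd (ξ : ℝ) := hasDerivAt_expProfile k (fun i => hσd i ξ) r
  have hwc : Continuous w := continuous_iff_continuousAt.mpr fun ξ => (hwd ξ).continuousAt
  set ε := Real.exp (-(r * c)) with hε
  have hε0 : 0 < ε := Real.exp_pos _
  -- The exponential ansatz satisfies the boundary condition up to an exponentially small error.
  have hdefect : ‖sys.WB *ᵥ Sum.elim (G sys.b *ᵥ w sys.b) (G sys.a *ᵥ w sys.a)‖ ≤ B * ε := by
    have hb := norm_expProfile_sub_le k (ξ := sys.b) hr p hpb hnb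
    have ha := norm_expProfile_sub_le k (ξ := sys.a) hr (fun i => ¬p i) hna
      (fun i hi => hpa i (not_not.mp hi))
    simp only [ite_not] at ha
    have hsplit : Sum.elim (G sys.b *ᵥ w sys.b) (G sys.a *ᵥ w sys.a) =
        Sum.elim (G sys.b *ᵥ fun i => if p i then k i else 0)
          (G sys.a *ᵥ fun i => if p i then 0 else k i) +
        Sum.elim (G sys.b *ᵥ (w sys.b - fun i => if p i then k i else 0))
          (G sys.a *ᵥ (w sys.a - fun i => if p i then 0 else k i)) := by
      ext (i | i) <;> simp [Matrix.mulVec_sub]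
    rw [hsplit, Matrix.mulVec_add, hk, zero_add]
    refine (hWb _).trans ?_
    rw [hB, mul_assoc, mul_assoc]
    refine mul_le_mul_of_nonneg_left ?_ hcW0
    refine (pi_norm_le_iff_of_nonneg (by positivity)).mpr ?_
    rintro (i | i)
    · exact (norm_le_pi_norm (G sys.b *ᵥ _) i).trans
        ((hGb _ hbI _).trans (mul_le_mul_of_nonneg_left hb hcG))
    · exact (norm_le_pi_norm (G sys.a *ᵥ _) i).trans
        ((hGb _ haI _).trans (mul_le_mul_of_nonneg_left ha hcG))
  -- The affine `g` cancels the boundary defect, so `G w + g` satisfies the boundary condition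
  -- exactly.
  obtain ⟨g, g', hgd, hgb, hgb', hgbc⟩ :=
    hlift (-(sys.WB *ᵥ Sum.elim (G sys.b *ᵥ w sys.b) (G sys.a *ᵥ w sys.a)))
  rw [norm_neg] at hgb'
  simp only [norm_neg] at hgb
  have hle : cg * ‖sys.WB *ᵥ Sum.elim (G sys.b *ᵥ w sys.b) (G sys.a *ᵥ w sys.a)‖ ≤
      cg * B * ε := by
    rw [mul_assoc]
    exact mul_le_mul_of_nonneg_left hdefect hcg
  have hgc : Continuous g := continuous_iff_continuousAt.mpr fun ξ => (hgd ξ).continuousAt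
  obtain ⟨x, y, hxy, hx, hy⟩ := sys.exists_operator hP₀ hN hHN
    (v := fun ξ => G ξ *ᵥ w ξ + g ξ)
    (w := fun ξ => G' ξ *ᵥ w ξ +
      G ξ *ᵥ ((r : 𝕜) • (Matrix.diagonal (fun i => (d i ξ : 𝕜)) *ᵥ w ξ)) + g')
    (fun ξ hξ => (hasDerivWithinAt_mulVec (hGG' ξ hξ) (hwd ξ).hasDerivWithinAt).add
      (hgd ξ).hasDerivWithinAt)
    (by
      have hD : Continuous fun ξ => Matrix.diagonal (fun i => (d i ξ : 𝕜)) :=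
        Continuous.matrix_diagonal (continuous_pi fun i => RCLike.continuous_ofReal.comp (hd i))
      have hDw : Continuous fun ξ =>
          (r : 𝕜) • (Matrix.diagonal (fun i => (d i ξ : 𝕜)) *ᵥ w ξ) :=
        (continuous_const_smul (r : 𝕜)).comp (hD.matrix_mulVec hwc)
      exact ((hG'.mulVec_fun hwc.continuousOn).add (hG.mulVec_fun hDw.continuousOn)).add
        continuousOn_const)
    (by
      have hsum : Sum.elim (G sys.b *ᵥ w sys.b + g sys.b) (G sys.a *ᵥ w sys.a + g sys.a) =
          Sum.elim (G sys.b *ᵥ w sys.b) (G sys.a *ᵥ w sys.a) + Sum.elim (g sys.b) (g sys.a) := by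
        ext (i | i) <;> rfl
      simp only [hsum, Matrix.mulVec_add, hgbc, add_neg_cancel])
  -- Pointwise estimates.
  have hpt : ∀ᵐ ξ ∂μ, ‖w ξ‖ ≤ cL * ‖x ξ‖ + cL * cN * (cg * B * ε) ∧
      ‖((r : 𝕜) • x - y) ξ‖ ≤ cE * A₁ * ‖x ξ‖ + cE * (A₂ * (r + 1) * (cg * B * ε)) := by
    filter_upwards [hx, hy, hP₀b, ae_restrict_mem measurableSet_Icc,
      Lp.coeFn_sub ((r : 𝕜) • x) y, Lp.coeFn_smul (r : 𝕜) x] with ξ h1 h2 h3 hξ h4 h5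
    have hest := norm_resolvent_defect_le (w := w ξ) hr hcP hcP₀ hcN hcL hcG hcG' (hPb ξ hξ) h3
      (hNb ξ hξ) (hLb ξ hξ) (hGb ξ hξ) (hGb' ξ hξ) (hLNG ξ hξ) (hPGD ξ hξ)
      ((hgb ξ hξ).trans hle) (hgb'.trans hle)
    rw [← h1, ← h2] at hest
    have hxle : ‖(x ξ).ofLp‖ ≤ ‖x ξ‖ :=
      (pi_norm_le_iff_of_nonneg (norm_nonneg _)).mpr fun i => PiLp.norm_apply_le _ i
    refine ⟨hest.1.trans (by gcongr), ?_⟩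
    have h6 : (((r : 𝕜) • x - y : sys.StateSpace) ξ).ofLp = (r : 𝕜) • (x ξ).ofLp - (y ξ).ofLp := by
      rw [h4, Pi.sub_apply, h5, Pi.smul_apply, WithLp.ofLp_sub, WithLp.ofLp_smul]
    calc _ ≤ cE * ‖(r : 𝕜) • (x ξ).ofLp - (y ξ).ofLp‖ := by
          rw [← h6]
          exact hEb _
      _ ≤ cE * (A₁ * ‖x ξ‖ + A₂ * (r + 1) * (cg * B * ε)) := by
          refine mul_le_mul_of_nonneg_left (hest.2.trans ?_) hcE
          gcongr
      _ = _ := by ring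
  refine ⟨‖x‖, ‖(r : 𝕜) • x - y‖, norm_nonneg _, hres r hr₀ x y hxy, ?_, ?_⟩
  · refine (Lp.norm_le_mul_norm_add_of_ae_le x ((r : 𝕜) • x - y) (by positivity) (by positivity)
      (hpt.mono fun ξ h => h.2)).trans (le_of_eq ?_)
    rw [← hV]
    ring
  -- The lower bound for `‖x‖` comes from comparing `x` with a constant multiple of the indicator of
  -- `J`.
  · set f : Lp ℝ 2 μ := indicatorConstLp 2 hJm (measure_ne_top μ J)
      (‖k i₀‖ * Real.exp (-(r * (c / 2)))) with hf
    have hfn : ‖f‖ = ‖k i₀‖ * Real.exp (-(r * (c / 2))) * U := by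
      rw [hf, norm_indicatorConstLp (by norm_num) (by norm_num),
        Real.norm_of_nonneg (by positivity), hU]
      norm_num
    have hfx := Lp.norm_le_mul_norm_add_of_ae_le (C := cL) (δ := cL * cN * (cg * B * ε)) x f hcL
      (by positivity) <| by
        filter_upwards [hpt, indicatorConstLp_coeFn (p := 2) (hs := hJm)
          (hμs := measure_ne_top μ J) (c := ‖k i₀‖ * Real.exp (-(r * (c / 2))))] with ξ h1 h2
        rw [hf, h2]
        by_cases hξ : ξ ∈ J
        · rw [indicator_of_mem hξ, Real.norm_of_nonneg (by positivity)]
          refine le_trans ?_ ((norm_le_pi_norm (w ξ) i₀).trans h1.1)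
          rw [hw, norm_expProfile_apply]
          refine mul_le_mul_of_nonneg_left (Real.exp_le_exp.mpr ?_) (norm_nonneg _)
          exact neg_le_neg (mul_le_mul_of_nonneg_left (le_of_lt hξ) hr)
        · rw [indicator_of_notMem hξ, norm_zero]
          positivity
    rw [hfn, ← hV] at hfx
    have t1 : 0 ≤ cL * cN * (cg * B) * V * ‖x‖ := by positivity
    have t2 : 0 ≤ cL * ε := by positivity
    linarith

end Ansatz

/-! ### `C¹` regularity of inverses and products -/

section Smoothness

variable {𝕜 : Type*} [RCLike 𝕜] {n : ℕ}

lemma contDiffOn_det {A : ℝ → Matrix (Fin n) (Fin n) 𝕜} {s : Set ℝ}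
    (hA : ∀ i j, ContDiffOn ℝ 1 (fun ξ => A ξ i j) s) :
    ContDiffOn ℝ 1 (fun ξ => (A ξ).det) s := by
  simp only [Matrix.det_apply']
  exact ContDiffOn.sum fun π _ => contDiffOn_const.mul (contDiffOn_prod fun i _ => hA _ _)

/-- Cramer's rule: entries of the adjugate are determinants of matrices with `C¹` entries. -/
lemma contDiffOn_inv_apply {A : ℝ → Matrix (Fin n) (Fin n) 𝕜} {s : Set ℝ}
    (hA : ∀ i j, ContDiffOn ℝ 1 (fun ξ => A ξ i j) s) (hAu : ∀ ξ ∈ s, IsUnit (A ξ))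
    (i j : Fin n) : ContDiffOn ℝ 1 (fun ξ => (A ξ)⁻¹ i j) s := by
  simp only [Matrix.inv_def, Ring.inverse_eq_inv', Matrix.smul_apply, smul_eq_mul,
    Matrix.adjugate_apply]
  refine ((contDiffOn_det hA).inv fun ξ hξ =>
    ((Matrix.isUnit_iff_isUnit_det _).mp (hAu ξ hξ)).ne_zero).mul (contDiffOn_det fun i' j' => ?_)
  by_cases h : i' = j
  · subst h
    simp only [Matrix.updateRow_self]
    exact contDiffOn_const
  · simp only [Matrix.updateRow_ne h]
    exact hA i' j'

lemma contDiffOn_const_mul_mul_const_apply {A : ℝ → Matrix (Fin n) (Fin n) 𝕜} {s : Set ℝ}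
    (hA : ∀ i j, ContDiffOn ℝ 1 (fun ξ => A ξ i j) s) (B C : Matrix (Fin n) (Fin n) 𝕜)
    (i j : Fin n) : ContDiffOn ℝ 1 (fun ξ => (B * A ξ * C) i j) s := by
  simp only [Matrix.mul_apply]
  exact ContDiffOn.sum fun l _ =>
    (ContDiffOn.sum fun l' _ => contDiffOn_const.mul (hA l' l)).mul contDiffOn_const

lemma continuousOn_of_contDiffOn_apply {A : ℝ → Matrix (Fin n) (Fin n) 𝕜} {s : Set ℝ}
    (hA : ∀ i j, ContDiffOn ℝ 1 (fun ξ => A ξ i j) s) : ContinuousOn A s :=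
  continuousOn_pi.mpr fun i => continuousOn_pi.mpr fun j => (hA i j).continuousOn

end Smoothness

/-! ### Travel times and invertibility of the incoming boundary matrix -/

section WellPosedness

variable {𝕜 : Type*} [RCLike 𝕜] {n : ℕ}

lemma signMatrix_mul_self (m : ℕ) : signMatrix 𝕜 n m * signMatrix 𝕜 n m = 1 := by
  rw [signMatrix, Matrix.diagonal_mul_diagonal, ← Matrix.diagonal_one]
  congr 1
  funext i
  by_cases h : (i : ℕ) < m <;> simp [h]

lemma Matrix.IsDiag.eq_diagonal_ofReal {A : Matrix (Fin n) (Fin n) 𝕜} (hA : A.IsDiag)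
    (hA' : A.PosDef) : A = Matrix.diagonal fun i => ((RCLike.re (A i i) : ℝ) : 𝕜) := by
  conv_lhs => rw [← hA.diagonal_diag]
  congr 1
  funext i
  exact ((RCLike.pos_iff_exists_ofReal.mp (hA'.diag_pos (i := i))).elim fun r hr => by
    rw [Matrix.diag_apply, ← hr.2, RCLike.ofReal_re])

/-- Travel times of the characteristics: given continuous speeds `h i > 0` on `[a, b]`, there are
phases `σ i` vanishing at the incoming end, bounded below at the outgoing end, and satisfying
`σᵢ' = ∓ 1 / hᵢ`. -/
lemma exists_phase {a b : ℝ} (hab : a < b) (p : Fin n → Prop) [DecidablePred p]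
    {h : Fin n → ℝ → ℝ} (hc : ∀ i, ContinuousOn (h i) (Icc a b))
    (hpos : ∀ i, ∀ ξ ∈ Icc a b, 0 < h i ξ) :
    ∃ (σ d : Fin n → ℝ → ℝ) (c : ℝ), 0 < c ∧ (∀ i, Continuous (d i)) ∧
      (∀ i ξ, HasDerivAt (σ i) (-d i ξ) ξ) ∧
      (∀ i, ∀ ξ ∈ Icc a b, d i ξ = (if p i then 1 else -1) * (h i ξ)⁻¹) ∧
      (∀ i, p i → σ i b = 0 ∧ c ≤ σ i a) ∧ (∀ i, ¬p i → σ i a = 0 ∧ c ≤ σ i b) := by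
  -- Constant extension outside `[a, b]` makes `q i` continuous on `ℝ`, so its primitive is
  -- differentiable everywhere, endpoints included.
  set q : Fin n → ℝ → ℝ := fun i ξ => (h i (projIcc a b hab.le ξ))⁻¹ with hq
  have hproj (i : Fin n) (ξ : ℝ) : 0 < h i (projIcc a b hab.le ξ) :=
    hpos i _ (projIcc a b hab.le ξ).2
  have hqc (i : Fin n) : Continuous (q i) :=
    ((hc i).comp_continuous (continuous_subtype_val.comp continuous_projIcc)
      fun ξ => (projIcc a b hab.le ξ).2).inv₀ fun ξ => (hproj i ξ).ne'
  have hτ (i : Fin n) (ξ : ℝ) : HasDerivAt (fun ξ => ∫ t in a..ξ, q i t) (q i ξ) ξ :=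
    (hqc i).integral_hasStrictDerivAt a ξ |>.hasDerivAt
  have hτpos (i : Fin n) : 0 < ∫ t in a..b, q i t :=
    intervalIntegral.intervalIntegral_pos_of_pos ((hqc i).intervalIntegrable a b)
      (fun ξ => inv_pos.mpr (hproj i ξ)) hab
  obtain ⟨c, hc0, hcle⟩ : ∃ c, 0 < c ∧ ∀ i, c ≤ ∫ t in a..b, q i t := by
    rcases isEmpty_or_nonempty (Fin n) with he | he
    · exact ⟨1, one_pos, fun i => he.elim i⟩
    · obtain ⟨i, hi⟩ := Finite.exists_min fun i => ∫ t in a..b, q i t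
      exact ⟨_, hτpos i, hi⟩
  refine ⟨fun i ξ => if p i then (∫ t in a..b, q i t) - ∫ t in a..ξ, q i t
    else ∫ t in a..ξ, q i t, fun i ξ => (if p i then 1 else -1) * q i ξ, c, hc0,
    fun i => continuous_const.mul (hqc i), fun i ξ => ?_, fun i ξ hξ => ?_, fun i hi => ?_,
    fun i hi => ?_⟩
  · by_cases hi : p i
    · simpa [hi] using (hτ i ξ).const_sub (∫ t in a..b, q i t)
    · simpa [hi] using hτ i ξ
  · simp only [hq, projIcc_of_mem hab.le hξ]
  · simpa [hi] using hcle i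
  · simpa [hi] using hcle i

/-- For a generator, incoming boundary values of the diagonalised system are determined by the
boundary condition. -/
theorem HBCS.isUnit_diagonalise_WB_mul (sys : HBCS 𝕜 n) (hsys : sys.StandingAssumption) (m : ℕ)
    (S HD : ℝ → Matrix (Fin n) (Fin n) 𝕜) (hdiag : sys.IsC1Diagonalisation m S HD) :
    IsUnit ((sys.diagonalise m S HD).WB *
      Matrix.fromRows (headProj 𝕜 n m) (tailProj 𝕜 n m)) := by
  rw [Matrix.isUnit_iff_isUnit_det, isUnit_iff_ne_zero, Ne, ← Matrix.exists_mulVec_eq_zero_iff]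
  rintro ⟨k, hk0, hk⟩
  refine hk0 ?_
  have hab := hsys.a_lt_b
  set h : Fin n → ℝ → ℝ := fun i ξ => RCLike.re (HD ξ i i) with hh
  have hpos : ∀ i, ∀ ξ ∈ Icc sys.a sys.b, 0 < h i ξ := fun i ξ hξ =>
    (RCLike.pos_iff.mp ((hdiag.HD_posDef ξ hξ).diag_pos (i := i))).1
  have hhc : ∀ i, ContinuousOn (h i) (Icc sys.a sys.b) := fun i =>
    RCLike.continuous_re.comp_continuousOn (hdiag.HD_contDiff i i).continuousOn
  obtain ⟨σ, d, c, hc, hdc, hσd, hdh, hp, hn⟩ :=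
    exists_phase hab (fun i : Fin n => (i : ℕ) < m) hhc hpos
  set Q : ℝ → Matrix (Fin n) (Fin n) 𝕜 := fun ξ =>
    Matrix.diagonal fun i => (((h i ξ)⁻¹ : ℝ) : 𝕜) with hQ
  set Z := signMatrix 𝕜 n m with hZ
  have hHDQ : ∀ ξ ∈ Icc sys.a sys.b, HD ξ * Q ξ = 1 := fun ξ hξ => by
    rw [(hdiag.HD_isDiag ξ hξ).eq_diagonal_ofReal (hdiag.HD_posDef ξ hξ), hQ,
      Matrix.diagonal_mul_diagonal, ← Matrix.diagonal_one]
    congr 1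
    funext i
    rw [← RCLike.ofReal_mul, mul_inv_cancel₀ (hpos i ξ hξ).ne', RCLike.ofReal_one]
  have hSR : ∀ ξ ∈ Icc sys.a sys.b, S ξ * (S ξ)⁻¹ = 1 := fun ξ hξ =>
    Matrix.mul_nonsing_inv _ ((Matrix.isUnit_iff_isUnit_det _).mp (hdiag.S_isUnit ξ hξ))
  have hRS : ∀ ξ ∈ Icc sys.a sys.b, (S ξ)⁻¹ * S ξ = 1 := fun ξ hξ =>
    Matrix.nonsing_inv_mul _ ((Matrix.isUnit_iff_isUnit_det _).mp (hdiag.S_isUnit ξ hξ))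
  have hPP : sys.P₁ * sys.P₁⁻¹ = 1 :=
    Matrix.mul_nonsing_inv _ ((Matrix.isUnit_iff_isUnit_det _).mp hsys.P₁_isUnit)
  have hPP' : sys.P₁⁻¹ * sys.P₁ = 1 :=
    Matrix.nonsing_inv_mul _ ((Matrix.isUnit_iff_isUnit_det _).mp hsys.P₁_isUnit)
  have hZZ : Z * Z = 1 := signMatrix_mul_self m
  have hRd := contDiffOn_inv_apply hdiag.S_contDiff hdiag.S_isUnit
  have hGd := contDiffOn_const_mul_mul_const_apply hRd sys.P₁⁻¹ Z
  have hRc := continuousOn_of_contDiffOn_apply hRd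
  have hSc := continuousOn_of_contDiffOn_apply hdiag.S_contDiff
  have hHDc := continuousOn_of_contDiffOn_apply hdiag.HD_contDiff
  have hQc : ContinuousOn Q (Icc sys.a sys.b) :=
    (Continuous.matrix_diagonal continuous_id).comp_continuousOn (continuousOn_pi.mpr fun i =>
      RCLike.continuous_ofReal.comp_continuousOn
        ((hhc i).inv₀ fun ξ hξ => (hpos i ξ hξ).ne'))
  have hNG : ∀ ξ ∈ Icc sys.a sys.b,
      (S ξ)⁻¹ * Q ξ * Z * S ξ * sys.P₁ * (sys.P₁⁻¹ * (S ξ)⁻¹ * Z) = (S ξ)⁻¹ * Q ξ := by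
    intro ξ hξ
    calc _ = (S ξ)⁻¹ * Q ξ * (Z * (S ξ * (sys.P₁ * sys.P₁⁻¹) * (S ξ)⁻¹) * Z) := by noncomm_ring
      _ = _ := by rw [hPP, mul_one, hSR ξ hξ, mul_one, hZZ, mul_one]
  -- Here `N` is the continuous version of `𝓗⁻¹` obtained by inverting `P₁ 𝓗 = S⁻¹ P₁ᴰ 𝓗ᴰ S`. As `𝓗
  -- x = G (𝓗ᴰ S x)`, the diagonal coordinate is `w = 𝓗ᴰ S x`, and `L` recovers it from `x`.
  refine sys.incoming_eq_zero hab hsys.P₀_memLp hsys.WB_rank hsys.generates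
    (N := fun ξ => (S ξ)⁻¹ * Q ξ * Z * S ξ * sys.P₁) (L := fun ξ => HD ξ * S ξ)
    (G := fun ξ => sys.P₁⁻¹ * (S ξ)⁻¹ * Z)
    (G' := fun ξ => Matrix.of fun i j =>
      derivWithin (fun η => (sys.P₁⁻¹ * (S η)⁻¹ * Z) i j) (Icc sys.a sys.b) ξ)
    ((((hRc.mul hQc).mul continuousOn_const).mul hSc).mul continuousOn_const) (hHDc.mul hSc)
    (continuousOn_pi.mpr fun i => continuousOn_pi.mpr fun j =>
      (hGd i j).continuousOn_derivWithin (uniqueDiffOn_Icc hab) le_rfl)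
    (fun ξ hξ i j => ((hGd i j).differentiableOn one_ne_zero ξ hξ).hasDerivWithinAt)
    ?_ ?_ ?_ hσd hdc hc (fun i : Fin n => (i : ℕ) < m) (fun i hi => (hp i hi).1)
    (fun i hi => (hp i hi).2) (fun i hi => (hn i hi).1) (fun i hi => (hn i hi).2) k ?_
  · filter_upwards [hdiag.diag_eq, ae_restrict_mem measurableSet_Icc] with ξ h1 hξ
    calc _ = sys.P₁⁻¹ * sys.P₁ * sys.H ξ * ((S ξ)⁻¹ * Q ξ * Z * S ξ * sys.P₁) := by
          rw [hPP', one_mul]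
      _ = sys.P₁⁻¹ * (sys.P₁ * sys.H ξ) * ((S ξ)⁻¹ * Q ξ * Z * S ξ * sys.P₁) := by noncomm_ring
      _ = sys.P₁⁻¹ * ((S ξ)⁻¹ * (Z * (HD ξ * (S ξ * (S ξ)⁻¹) * Q ξ) * Z) * S ξ) * sys.P₁ := by
          rw [h1]
          noncomm_ring
      _ = 1 := by
          rw [hSR ξ hξ, mul_one, hHDQ ξ hξ, mul_one, hZZ, mul_one, hRS ξ hξ, mul_one, hPP']
  · intro ξ hξ
    rw [hNG ξ hξ]
    calc _ = HD ξ * (S ξ * (S ξ)⁻¹) * Q ξ := by noncomm_ring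
      _ = 1 := by rw [hSR ξ hξ, mul_one, hHDQ ξ hξ]
  · intro ξ hξ
    have hD : Matrix.diagonal (fun i => (d i ξ : 𝕜)) = Z * Q ξ := by
      rw [hZ, signMatrix, hQ, Matrix.diagonal_mul_diagonal]
      congr 1
      funext i
      rw [hdh i ξ hξ, RCLike.ofReal_mul]
      by_cases hi : (i : ℕ) < m <;> simp [hi]
    rw [hNG ξ hξ, hD]
    calc _ = sys.P₁ * sys.P₁⁻¹ * (S ξ)⁻¹ * (Z * Z) * Q ξ := by noncomm_ring
      _ = _ := by rw [hPP, hZZ, one_mul, mul_one]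
  · have h1 : headProj 𝕜 n m *ᵥ k = fun i : Fin n => if (i : ℕ) < m then k i else 0 := by
      funext i
      simp [headProj, Matrix.mulVec_diagonal]
    have h2 : tailProj 𝕜 n m *ᵥ k = fun i : Fin n => if (i : ℕ) < m then 0 else k i := by
      funext i
      simp [tailProj, Matrix.mulVec_diagonal]
    rw [← h1, ← h2, ← hk]
    simp only [diagonalise, boundaryTransform, ← Matrix.mulVec_mulVec, Matrix.fromRows_mulVec,
      Matrix.fromBlocks_mulVec, Matrix.zero_mulVec, add_zero, zero_add, Sum.elim_comp_inl,
      Sum.elim_comp_inr, hZ]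

end WellPosedness

/-! ### Conclusion -/

theorem mainTheorem5 {𝕜 : Type*} [RCLike 𝕜] {n : ℕ} (sys : HBCS 𝕜 n)
    (hsys : sys.StandingAssumption) (m : ℕ) (S HD : ℝ → Matrix (Fin n) (Fin n) 𝕜)
    (hdiag : sys.IsC1Diagonalisation m S HD) :
    IsUnit ((sys.diagonalise m S HD).WB *
      Matrix.fromRows (projPos (sys.diagonalise m S HD).P₁)
        (projNeg (sys.diagonalise m S HD).P₁)) ∧
    ∃ K M : Matrix (Fin n) (Fin n) 𝕜, IsUnit K ∧
      (sys.diagonalise m S HD).WB =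
        K * Matrix.fromCols
          (rootPos (sys.diagonalise m S HD).P₁ - M * rootNeg (sys.diagonalise m S HD).P₁)
          (rootNeg (sys.diagonalise m S HD).P₁ - M * rootPos (sys.diagonalise m S HD).P₁) := by
  have hP : (sys.diagonalise m S HD).P₁ = signMatrix 𝕜 n m := rfl
  have hunit := sys.isUnit_diagonalise_WB_mul hsys m S HD hdiag
  -- For the sign matrix `Q±ᴰ = P±ᴰ`, so both claims involve the same complementary projections.
  rw [hP, projPos_signMatrix, projNeg_signMatrix, rootPos_signMatrix, rootNeg_signMatrix]
  refine ⟨hunit, exists_factorization_of_isUnit _ ?_ ?_ ?_ ?_ ?_ hunit⟩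
  · simp [headProj]
  · simp [tailProj]
  · rw [headProj, tailProj, Matrix.diagonal_mul_diagonal, ← Matrix.diagonal_zero]
    congr 1
    funext i
    by_cases h : (i : ℕ) < m <;> simp [h]
  · rw [headProj, tailProj, Matrix.diagonal_mul_diagonal, ← Matrix.diagonal_zero]
    congr 1
    funext i
    by_cases h : (i : ℕ) < m <;> simp [h]
  · rw [headProj, tailProj, Matrix.diagonal_add, ← Matrix.diagonal_one]
    congr 1
    funext i
    by_cases h : (i : ℕ) < m <;> simp [h]
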